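/- **Language.** The finite types are generated from $0$ by $(\sigma,\tau)\mapsto(\sigma\to\tau)$; $1:=0\to0$ and $n+1:=n\to0$. The language $\mathsf{L}_\omega$ of higher-order arithmetic is the many-sorted language with variables of every finite type, constants $0,1$ of type $0$, $+,\times$ of type $0\to0\to0$, the combinators $\Pi_{\sigma,\tau}$ and $\Sigma_{\rho,\sigma,\tau}$, the recursors $\mathbf R_\sigma$, application, and the relations $=_0$ and $<_0$. Equality at type $\tau=(\tau_1\to\dots\to\tau_k\to0)$ abbreviates $x=_\tau y:\equiv(\forall z_1^{\tau_1}\dots z_k^{\tau_k})(xz_1\dots z_k=_0yz_1\dots z_k)$, and $x\le_\tau y$ is defined likewise from $\le_0$; in $x\le_\tau 1$, the symbol $1$ stands for the constant functional with value $1$. A formula is quantifier-free if it contains no quantifiers (variables of any type may occur). **Base theory.** $\mathsf{RCA}_0^\omega$ is the theory in classical many-sorted predicate logic with the axioms: (a) $0,1,<_0,+,\times$ form a (discretely) ordered semi-ring, with equality $=_0$; (b) $\Pi xy=_\sigma x$ and $\Sigma xyz=_\tau xz(yz)$; (c) $\mathbf R_0(f,m,0)=m$ and $\mathbf R_0(f,m,n+1)=f(\mathbf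 R_0(f,m,n))$ for $m^0$, $n^0$, $f^1$; (d) extensionality $(\forall x^\rho,y^\rho,\varphi^{\rho\to\tau})(x=_\rho y\to\varphi(x)=_\tau\varphi(y))$ for all types $\rho,\tau$; (e) induction for all quantifier-free formulas; (f) $\mathsf{QF\text{-}AC}^{1,0}$. Here $\mathsf{QF\text{-}AC}^{\sigma,\tau}$ is the schema $(\forall x^\sigma)(\exists y^\tau)A(x,y)\to(\exists Y^{\sigma\to\tau})(\forall x^\sigma)A(x,Y(x))$ for all quantifier-free $A$ (with parameters of any type). **Axioms.** Write $f\in C$ for $f\le_1 1$, write $\overline fN=\overline gN$ for $(\forall i<N)(f(i)=g(i))$, and write $Y^2\in\mathsf{cont}$ for $(\forall f^1)(\exists N^0)(\forall g^1)(\overline fN=\overline gN\to Y(f)=Y(g))$. Consider the sentences $$(\exists^2):\quad(\exists\varphi^2\le_2 1)(\forall f^1)\big[(\exists n^0)(f(n)=0)\leftrightarrow\varphi(f)=0\big],$$ $$(\exists^3):\quad(\exists E^3\le_3 1)(\forall Y^2)\big[(\exists f^1)(Y(f)=0)\leftrightarrow E(Y)=0\big],$$ $$\mathsf{MUC}:\quad(\exists\Omega^3)(\forall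 Y^2)(\forall f,g\in C)\big(\overline f\,\Omega(Y)=\overline g\,\Omega(Y)\to Y(f)=Y(g)\big),$$ $$\mathsf{FF}:\quad(\exists\Phi^3)(\forall Y^2\in\mathsf{cont})(\forall f,g\in C)\big(\overline f\,\Phi(Y)=\overline g\,\Phi(Y)\to Y(f)=Y(g)\big),$$ $$(Z^3):\quad(\exists Z^3)(\forall Y^2)\big[Z(Y)=0\leftrightarrow Y\in\mathsf{cont}\big].$$ **Theorem.** The system $\mathsf{RCA}_0^\omega+\mathsf{QF\text{-}AC}^{2,0}$ proves each of the following sentences: 1. $(\exists^2)\leftrightarrow[\mathsf{FF}\wedge\neg\mathsf{MUC}]$; 2. $(\exists^3)\leftrightarrow[\mathsf{FF}\wedge(Z^3)\wedge\neg\mathsf{MUC}]$; 3. $(Z^3)\leftrightarrow[(\exists^3)\vee\neg(\exists^2)]$; 4. $[(\exists^3)\vee\neg(\exists^2)]\leftrightarrow[(\exists^3)\vee\neg\mathsf{FF}\vee\mathsf{MUC}]$. -/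

import Mathlib

namespace HOA

/-- The finite types: `o` is the type `0` of natural numbers, `arr σ τ` is `σ → τ`. -/
inductive Ty : Type
  | o : Ty
  | arr : Ty → Ty → Ty

infixr:60 " ⇒ " => Ty.arr

/-- The pure types `0`, `1 = 0 → 0`, `2 = 1 → 0`, `3 = 2 → 0`. -/
abbrev T0 : Ty := Ty.o
abbrev T1 : Ty := T0 ⇒ T0
abbrev T2 : Ty := T1 ⇒ T0
abbrev T3 : Ty := T2 ⇒ T0

/-- A context lists the types of the free variables (de Bruijn indices). -/
abbrev Ctx : Type := List Ty

inductive Var : Ctx → Ty → Type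
  | z {Γ : Ctx} {σ : Ty} : Var (σ :: Γ) σ
  | s {Γ : Ctx} {σ τ : Ty} : Var Γ σ → Var (τ :: Γ) σ

/-- The constants of the language `L_ω`: `0`, `1`, `+`, `×`, the combinators `Π` (alias `K`) and
`Σ` (alias `S`), and the recursors `R_σ`. The relations `=₀` and `<₀` are atomic formulas below. -/
inductive Cst : Ty → Type
  | zero : Cst T0
  | one : Cst T0
  | add : Cst (T0 ⇒ T0 ⇒ T0)
  | mul : Cst (T0 ⇒ T0 ⇒ T0)
  | K (σ τ : Ty) : Cst (σ ⇒ τ ⇒ σ)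
  | S (ρ σ τ : Ty) : Cst ((ρ ⇒ σ ⇒ τ) ⇒ (ρ ⇒ σ) ⇒ ρ ⇒ τ)
  | R (σ : Ty) : Cst ((σ ⇒ σ) ⇒ σ ⇒ T0 ⇒ σ)

/-- Terms of `L_ω` in a given context. -/
inductive Tm (Γ : Ctx) : Ty → Type
  | var {σ : Ty} : Var Γ σ → Tm Γ σ
  | cst {σ : Ty} : Cst σ → Tm Γ σ
  | app {σ τ : Ty} : Tm Γ (σ ⇒ τ) → Tm Γ σ → Tm Γ τ

infixl:85 " ⬝ " => Tm.app

/-- Formulas of `L_ω` in a given context; equality is primitive at type `0` only. -/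
inductive Fm : Ctx → Type
  | eq {Γ : Ctx} : Tm Γ T0 → Tm Γ T0 → Fm Γ
  | lt {Γ : Ctx} : Tm Γ T0 → Tm Γ T0 → Fm Γ
  | bot {Γ : Ctx} : Fm Γ
  | and {Γ : Ctx} : Fm Γ → Fm Γ → Fm Γ
  | or {Γ : Ctx} : Fm Γ → Fm Γ → Fm Γ
  | imp {Γ : Ctx} : Fm Γ → Fm Γ → Fm Γ
  | all {Γ : Ctx} (σ : Ty) : Fm (σ :: Γ) → Fm Γ
  | ex {Γ : Ctx} (σ : Ty) : Fm (σ :: Γ) → Fm Γ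

/-- Sentences are formulas without free variables. -/
abbrev Sentence : Type := Fm []

abbrev Fm.neg {Γ : Ctx} (A : Fm Γ) : Fm Γ := A.imp Fm.bot
abbrev Fm.iff {Γ : Ctx} (A B : Fm Γ) : Fm Γ := (A.imp B).and (B.imp A)

infix:70 " ≐ " => Fm.eq
infix:70 " ≺ " => Fm.lt
infixr:65 " ⩑ " => Fm.and
infixr:60 " ⩒ " => Fm.or
infixr:55 " ⇾ " => Fm.imp
infix:50 " ⇿ " => Fm.iff
prefix:75 "∼" => Fm.neg

/-- Quantifier-free formulas (variables of any finite type may occur). -/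
def Fm.QF : {Γ : Ctx} → Fm Γ → Prop
  | _, .eq _ _ => True
  | _, .lt _ _ => True
  | _, .bot => True
  | _, .and A B => A.QF ∧ B.QF
  | _, .or A B => A.QF ∧ B.QF
  | _, .imp A B => A.QF ∧ B.QF
  | _, .all _ _ => False
  | _, .ex _ _ => False

/-! Renaming and simultaneous capture-avoiding substitution. -/

abbrev Ren (Γ Δ : Ctx) : Type := ∀ σ : Ty, Var Γ σ → Var Δ σ

def Ren.lift {Γ Δ : Ctx} (r : Ren Γ Δ) (τ : Ty) : Ren (τ :: Γ) (τ :: Δ)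
  | _, .z => .z
  | _, .s x => .s (r _ x)

def Tm.ren {Γ Δ : Ctx} (r : Ren Γ Δ) : {σ : Ty} → Tm Γ σ → Tm Δ σ
  | _, .var x => .var (r _ x)
  | _, .cst c => .cst c
  | _, .app s t => .app (s.ren r) (t.ren r)

def Fm.ren : {Γ Δ : Ctx} → Ren Γ Δ → Fm Γ → Fm Δ
  | _, _, r, .eq s t => .eq (s.ren r) (t.ren r)
  | _, _, r, .lt s t => .lt (s.ren r) (t.ren r)
  | _, _, _, .bot => .bot
  | _, _, r, .and A B => .and (A.ren r) (B.ren r)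
  | _, _, r, .or A B => .or (A.ren r) (B.ren r)
  | _, _, r, .imp A B => .imp (A.ren r) (B.ren r)
  | _, _, r, .all σ A => .all σ (A.ren (r.lift σ))
  | _, _, r, .ex σ A => .ex σ (A.ren (r.lift σ))

/-- Weakening by one fresh variable. -/
def Tm.wk {Γ : Ctx} {σ : Ty} (τ : Ty) (t : Tm Γ σ) : Tm (τ :: Γ) σ := t.ren fun _ x => .s x
def Fm.wk {Γ : Ctx} (τ : Ty) (A : Fm Γ) : Fm (τ :: Γ) := A.ren fun _ x => .s x

abbrev Sub (Γ Δ : Ctx) : Type := ∀ σ : Ty, Var Γ σ → Tm Δ σ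

def Sub.lift {Γ Δ : Ctx} (θ : Sub Γ Δ) (τ : Ty) : Sub (τ :: Γ) (τ :: Δ)
  | _, .z => .var .z
  | _, .s x => (θ _ x).wk τ

def Tm.sub {Γ Δ : Ctx} (θ : Sub Γ Δ) : {σ : Ty} → Tm Γ σ → Tm Δ σ
  | _, .var x => θ _ x
  | _, .cst c => .cst c
  | _, .app s t => .app (s.sub θ) (t.sub θ)

def Fm.sub : {Γ Δ : Ctx} → Sub Γ Δ → Fm Γ → Fm Δ
  | _, _, θ, .eq s t => .eq (s.sub θ) (t.sub θ)
  | _, _, θ, .lt s t => .lt (s.sub θ) (t.sub θ)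
  | _, _, _, .bot => .bot
  | _, _, θ, .and A B => .and (A.sub θ) (B.sub θ)
  | _, _, θ, .or A B => .or (A.sub θ) (B.sub θ)
  | _, _, θ, .imp A B => .imp (A.sub θ) (B.sub θ)
  | _, _, θ, .all σ A => .all σ (A.sub (θ.lift σ))
  | _, _, θ, .ex σ A => .ex σ (A.sub (θ.lift σ))

/-- Substitute `t` for the variable `0` and keep the others. -/
def Sub.single {Γ : Ctx} {τ : Ty} (t : Tm Γ τ) : Sub (τ :: Γ) Γ
  | _, .z => t
  | _, .s x => .var x

/-- `A[t/x]`, where `x` is the variable `0`. -/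
def Fm.inst {Γ : Ctx} {τ : Ty} (A : Fm (τ :: Γ)) (t : Tm Γ τ) : Fm Γ := A.sub (Sub.single t)

/-! Abbreviations for terms and formulas. -/

def v0 {Γ : Ctx} {a : Ty} : Tm (a :: Γ) a := .var .z
def v1 {Γ : Ctx} {a b : Ty} : Tm (b :: a :: Γ) a := .var (.s .z)
def v2 {Γ : Ctx} {a b c : Ty} : Tm (c :: b :: a :: Γ) a := .var (.s (.s .z))
def v3 {Γ : Ctx} {a b c d : Ty} : Tm (d :: c :: b :: a :: Γ) a := .var (.s (.s (.s .z)))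

def zero {Γ : Ctx} : Tm Γ T0 := .cst .zero
def one {Γ : Ctx} : Tm Γ T0 := .cst .one
def add {Γ : Ctx} (s t : Tm Γ T0) : Tm Γ T0 := .cst .add ⬝ s ⬝ t
def mul {Γ : Ctx} (s t : Tm Γ T0) : Tm Γ T0 := .cst .mul ⬝ s ⬝ t
def kk {Γ : Ctx} (σ τ : Ty) : Tm Γ (σ ⇒ τ ⇒ σ) := .cst (.K σ τ)
def ss {Γ : Ctx} (ρ σ τ : Ty) : Tm Γ ((ρ ⇒ σ ⇒ τ) ⇒ (ρ ⇒ σ) ⇒ ρ ⇒ τ) := .cst (.S ρ σ τ)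
def rr {Γ : Ctx} (σ : Ty) : Tm Γ ((σ ⇒ σ) ⇒ σ ⇒ T0 ⇒ σ) := .cst (.R σ)

/-- `s ≤₀ t`. -/
def le {Γ : Ctx} (s t : Tm Γ T0) : Fm Γ := s ≺ t ⩒ s ≐ t

/-- Defined equality `s =_τ t` at any type:
`∀ z₁ … z_k, s z₁ … z_k =₀ t z₁ … z_k` for `τ = τ₁ → … → τ_k → 0`. -/
def eqT : {Γ : Ctx} → (τ : Ty) → Tm Γ τ → Tm Γ τ → Fm Γ
  | _, .o, s, t => s ≐ t
  | _, .arr σ τ, s, t => .all σ (eqT τ (s.wk σ ⬝ v0) (t.wk σ ⬝ v0))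

/-- `t ≤_τ 1`: `∀ z₁ … z_k, t z₁ … z_k ≤₀ 1` for `τ = τ₁ → … → τ_k → 0`. -/
def leOne : {Γ : Ctx} → (τ : Ty) → Tm Γ τ → Fm Γ
  | _, .o, t => le t one
  | _, .arr σ τ, t => .all σ (leOne τ (t.wk σ ⬝ v0))

/-- `f ∈ C` (Cantor space), i.e. `f ≤₁ 1`. -/
def inC {Γ : Ctx} (f : Tm Γ T1) : Fm Γ := leOne T1 f

/-- The initial segments of length `n` of `f` and `g` are equal. -/
def agree {Γ : Ctx} (f g : Tm Γ T1) (n : Tm Γ T0) : Fm Γ :=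
  .all T0 (v0 ≺ n.wk T0 ⇾ f.wk T0 ⬝ v0 ≐ g.wk T0 ⬝ v0)

/-- `Y ∈ cont`: `(∀ f¹)(∃ N⁰)(∀ g¹)(f̄N = ḡN → Y f = Y g)`, continuity on Baire space. -/
def cont {Γ : Ctx} (Y : Tm Γ T2) : Fm Γ :=
  .all T1 (.ex T0 (.all T1
    (agree v2 v0 v1 ⇾ ((Y.wk T1).wk T0).wk T1 ⬝ v2 ≐ ((Y.wk T1).wk T0).wk T1 ⬝ v0)))

/-- `(∀ f, g ∈ C)(f̄n = ḡn → Y f = Y g)`. -/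
def unifContC {Γ : Ctx} (Y : Tm Γ T2) (n : Tm Γ T0) : Fm Γ :=
  .all T1 (.all T1 (inC v1 ⩑ inC v0 ⇾
    agree v1 v0 ((n.wk T1).wk T1) ⇾ (Y.wk T1).wk T1 ⬝ v1 ≐ (Y.wk T1).wk T1 ⬝ v0))

/-! Theories and classical provability. -/

/-- A theory is given by its (possibly open) axioms in every context. -/
abbrev Theory : Type := (Γ : Ctx) → Set (Fm Γ)

/-- Natural deduction for many-sorted classical predicate logic: `Prf T H A` says that `A` is
derivable from the axioms of `T` and the list `H` of open assumptions. -/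
inductive Prf (T : Theory) : {Γ : Ctx} → List (Fm Γ) → Fm Γ → Prop
  | ax {Γ : Ctx} {H : List (Fm Γ)} {A : Fm Γ} : A ∈ T Γ → Prf T H A
  | hyp {Γ : Ctx} {H : List (Fm Γ)} {A : Fm Γ} : A ∈ H → Prf T H A
  | impI {Γ : Ctx} {H : List (Fm Γ)} {A B : Fm Γ} : Prf T (A :: H) B → Prf T H (A ⇾ B)
  | impE {Γ : Ctx} {H : List (Fm Γ)} {A B : Fm Γ} : Prf T H (A ⇾ B) → Prf T H A → Prf T H B
  | andI {Γ : Ctx} {H : List (Fm Γ)} {A B : Fm Γ} : Prf T H A → Prf T H B → Prf T H (A ⩑ B)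
  | andL {Γ : Ctx} {H : List (Fm Γ)} {A B : Fm Γ} : Prf T H (A ⩑ B) → Prf T H A
  | andR {Γ : Ctx} {H : List (Fm Γ)} {A B : Fm Γ} : Prf T H (A ⩑ B) → Prf T H B
  | orL {Γ : Ctx} {H : List (Fm Γ)} {A B : Fm Γ} : Prf T H A → Prf T H (A ⩒ B)
  | orR {Γ : Ctx} {H : List (Fm Γ)} {A B : Fm Γ} : Prf T H B → Prf T H (A ⩒ B)
  | orE {Γ : Ctx} {H : List (Fm Γ)} {A B D : Fm Γ} :
      Prf T H (A ⩒ B) → Prf T (A :: H) D → Prf T (B :: H) D → Prf T H D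
  | raa {Γ : Ctx} {H : List (Fm Γ)} {A : Fm Γ} : Prf T (∼A :: H) .bot → Prf T H A
  | allI {Γ : Ctx} {H : List (Fm Γ)} {σ : Ty} {A : Fm (σ :: Γ)} :
      Prf T (H.map (Fm.wk σ)) A → Prf T H (.all σ A)
  | allE {Γ : Ctx} {H : List (Fm Γ)} {σ : Ty} {A : Fm (σ :: Γ)} (t : Tm Γ σ) :
      Prf T H (.all σ A) → Prf T H (A.inst t)
  | exI {Γ : Ctx} {H : List (Fm Γ)} {σ : Ty} {A : Fm (σ :: Γ)} (t : Tm Γ σ) :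
      Prf T H (A.inst t) → Prf T H (.ex σ A)
  | exE {Γ : Ctx} {H : List (Fm Γ)} {σ : Ty} {A : Fm (σ :: Γ)} {B : Fm Γ} :
      Prf T H (.ex σ A) → Prf T (A :: H.map (Fm.wk σ)) (B.wk σ) → Prf T H B

/-- The theory `T` proves the sentence `A`. -/
def Theory.Proves (T : Theory) (A : Sentence) : Prop := Prf T [] A

/-- `A(x, Y x)`, in variables `x` (index 0) and `Y` (index 1), for `A(x, y)` with `y` the variable
`0` and `x` the variable `1`. -/
def choiceSub (Γ : Ctx) (σ τ : Ty) : Sub (τ :: σ :: Γ) (σ :: (σ ⇒ τ) :: Γ)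
  | _, .z => v1 ⬝ v0
  | _, .s .z => v0
  | _, .s (.s x) => .var (.s (.s x))

/-- The schema `QF-AC^{σ,τ}`: `(∀ x^σ)(∃ y^τ) A(x, y) → (∃ Y^{σ→τ})(∀ x^σ) A(x, Y x)` for
quantifier-free `A`, with arbitrary parameters. -/
inductive QFAC (σ τ : Ty) : Theory
  | intro {Γ : Ctx} (A : Fm (τ :: σ :: Γ)) : A.QF →
      QFAC σ τ Γ (.all σ (.ex τ A) ⇾ .ex (σ ⇒ τ) (.all σ (A.sub (choiceSub Γ σ τ))))

/-- `A(n + 1)`, in the variable `n` (index 0), for `A(n)`. -/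
def succSub (Γ : Ctx) : Sub (T0 :: Γ) (T0 :: Γ)
  | _, .z => add v0 one
  | _, .s x => .var (.s x)

/-- The base theory `RCA₀^ω`. Universal axioms are given through their term instances. -/
inductive RCA : Theory
  -- equality at type `0`
  | eq_refl {Γ : Ctx} (a : Tm Γ T0) : RCA Γ (a ≐ a)
  | eq_symm {Γ : Ctx} (a b : Tm Γ T0) : RCA Γ (a ≐ b ⇾ b ≐ a)
  | eq_trans {Γ : Ctx} (a b c : Tm Γ T0) : RCA Γ (a ≐ b ⇾ b ≐ c ⇾ a ≐ c)
  | lt_congr {Γ : Ctx} (a b c d : Tm Γ T0) : RCA Γ (a ≐ b ⇾ c ≐ d ⇾ a ≺ c ⇾ b ≺ d)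
  -- commutative semi-ring
  | add_assoc {Γ : Ctx} (a b c : Tm Γ T0) : RCA Γ (add (add a b) c ≐ add a (add b c))
  | add_comm {Γ : Ctx} (a b : Tm Γ T0) : RCA Γ (add a b ≐ add b a)
  | add_zero {Γ : Ctx} (a : Tm Γ T0) : RCA Γ (add a zero ≐ a)
  | mul_assoc {Γ : Ctx} (a b c : Tm Γ T0) : RCA Γ (mul (mul a b) c ≐ mul a (mul b c))
  | mul_comm {Γ : Ctx} (a b : Tm Γ T0) : RCA Γ (mul a b ≐ mul b a)
  | mul_one {Γ : Ctx} (a : Tm Γ T0) : RCA Γ (mul a one ≐ a)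
  | mul_zero {Γ : Ctx} (a : Tm Γ T0) : RCA Γ (mul a zero ≐ zero)
  | mul_add {Γ : Ctx} (a b c : Tm Γ T0) : RCA Γ (mul a (add b c) ≐ add (mul a b) (mul a c))
  -- discrete linear order with least element `0`, compatible with `+` and `×`
  | lt_irrefl {Γ : Ctx} (a : Tm Γ T0) : RCA Γ (∼(a ≺ a))
  | lt_trans {Γ : Ctx} (a b c : Tm Γ T0) : RCA Γ (a ≺ b ⇾ b ≺ c ⇾ a ≺ c)
  | lt_total {Γ : Ctx} (a b : Tm Γ T0) : RCA Γ (a ≺ b ⩒ a ≐ b ⩒ b ≺ a)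
  | add_lt_add {Γ : Ctx} (a b c : Tm Γ T0) : RCA Γ (a ≺ b ⇾ add a c ≺ add b c)
  | mul_lt_mul {Γ : Ctx} (a b c : Tm Γ T0) : RCA Γ (a ≺ b ⇾ zero ≺ c ⇾ mul a c ≺ mul b c)
  | zero_lt_one {Γ : Ctx} : RCA Γ (zero ≺ one)
  | zero_le {Γ : Ctx} (a : Tm Γ T0) : RCA Γ (le zero a)
  | discrete {Γ : Ctx} (a b : Tm Γ T0) : RCA Γ (a ≺ b ⇾ le (add a one) b)
  -- combinators and the recursor `R₀`
  | k_ax {Γ : Ctx} {σ τ : Ty} (x : Tm Γ σ) (y : Tm Γ τ) : RCA Γ (eqT σ (kk σ τ ⬝ x ⬝ y) x)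
  | s_ax {Γ : Ctx} {ρ σ τ : Ty} (x : Tm Γ (ρ ⇒ σ ⇒ τ)) (y : Tm Γ (ρ ⇒ σ)) (w : Tm Γ ρ) :
      RCA Γ (eqT τ (ss ρ σ τ ⬝ x ⬝ y ⬝ w) (x ⬝ w ⬝ (y ⬝ w)))
  | rec_zero {Γ : Ctx} (f : Tm Γ T1) (m : Tm Γ T0) : RCA Γ (rr T0 ⬝ f ⬝ m ⬝ zero ≐ m)
  | rec_succ {Γ : Ctx} (f : Tm Γ T1) (m n : Tm Γ T0) :
      RCA Γ (rr T0 ⬝ f ⬝ m ⬝ add n one ≐ f ⬝ (rr T0 ⬝ f ⬝ m ⬝ n))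
  -- extensionality `E_{ρ,τ}`
  | ext {Γ : Ctx} {ρ τ : Ty} (x y : Tm Γ ρ) (φ : Tm Γ (ρ ⇒ τ)) :
      RCA Γ (eqT ρ x y ⇾ eqT τ (φ ⬝ x) (φ ⬝ y))
  -- quantifier-free induction
  | ind {Γ : Ctx} (A : Fm (T0 :: Γ)) : A.QF →
      RCA Γ (A.inst zero ⩑ .all T0 (A ⇾ A.sub (succSub Γ)) ⇾ .all T0 A)
  -- `QF-AC^{1,0}`
  | qfac {Γ : Ctx} (A : Fm Γ) : A ∈ QFAC T1 T0 Γ → RCA Γ A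

/-- The theory `RCA₀^ω + QF-AC^{2,0}`. -/
def RCAQFAC20 : Theory := fun Γ => RCA Γ ∪ QFAC T2 T0 Γ

/-! The axioms of higher-order arithmetic. -/

/-- `(∃²)`: `(∃ φ² ≤₂ 1)(∀ f¹)[(∃ n)(f n = 0) ↔ φ f = 0]`. -/
def existsTwo : Sentence :=
  .ex T2 (leOne T2 v0 ⩑ .all T1 (.ex T0 (v1 ⬝ v0 ≐ zero) ⇿ v1 ⬝ v0 ≐ zero))

/-- `(∃³)`: `(∃ E³ ≤₃ 1)(∀ Y²)[(∃ f¹)(Y f = 0) ↔ E Y = 0]`. -/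
def existsThree : Sentence :=
  .ex T3 (leOne T3 v0 ⩑ .all T2 (.ex T1 (v1 ⬝ v0 ≐ zero) ⇿ v1 ⬝ v0 ≐ zero))

/-- `MUC`: `(∃ Ω³)(∀ Y²)(∀ f, g ∈ C)(f̄Ω(Y) = ḡΩ(Y) → Y f = Y g)`. -/
def MUC : Sentence := .ex T3 (.all T2 (unifContC v0 (v1 ⬝ v0)))

/-- `FF`: `(∃ Φ³)(∀ Y² ∈ cont)(∀ f, g ∈ C)(f̄Φ(Y) = ḡΦ(Y) → Y f = Y g)`. -/
def FF : Sentence := .ex T3 (.all T2 (cont v0 ⇾ unifContC v0 (v1 ⬝ v0)))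

/-- `(Z³)`: `(∃ Z³)(∀ Y²)[Z Y = 0 ↔ (∀ f¹)(∃ N⁰)(∀ g¹)(f̄N = ḡN → Y f = Y g)]`. -/
def ZThree : Sentence := .ex T3 (.all T2 (v1 ⬝ v0 ≐ zero ⇿ cont v0))

end HOA

namespace HOA

open Filter

/-! The proof is semantic. The first part is a completeness theorem for `Prf`: a sentence that holds
in all extensional models of a theory containing `RCA` is provable. The second part develops the
necessary mathematics inside an arbitrary, possibly nonstandard, model of `RCAQFAC20`.

Renaming and substitution. -/

/-! Provability is replaced by truth in models. If a sentence is unprovable, a Henkin construction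
on top of its negation gives a countable term model; the extensionality axioms make application well
defined on terms modulo provable equality, and the truth lemma makes the quotient extensional
(`proves_of_forall_sat`). It remains to verify the four equivalences in an arbitrary extensional
model, whose type 0 may be nonstandard. Every induction and every choice there must therefore
concern a predicate with a characteristic function in the model; the classes `Def` and `Dec` keep
track of this.

The mathematical core consists of three facts. (i) Grilliot's trick: a functional of type 2 that is
discontinuous somewhere on Baire space computes `(∃²)` (`hasE2_of_not_cont`). Hence without `(∃²)`
every functional is continuous, so `FF` is the same as `MUC`, and `(Z³)` holds with a constant
functional. (ii) `(∃²)` is itself discontinuous on Cantor space, so it refutes `MUC`. It also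
decides arithmetical predicates, so a compactness argument on coded binary sequences gives every
continuous functional a modulus on Cantor space (`Cont.exists_isMod`), and `QF-AC^{2,0}` chooses the
moduli uniformly, which is `FF`. (iii) In the presence of `(∃²)`, from `Y` one can define a
functional that is continuous exactly when `Y` has no zero (`cont_witness_iff`); a functional
deciding continuity therefore yields `(∃³)`. Conversely, `(∃³)` decides continuity outright. The
first three items follow from these facts, and the fourth follows from the first by propositional
logic. -/

theorem Ren.lift_toSub {Γ Δ : Ctx} (r : Ren Γ Δ) (τ : Ty) :
    Sub.lift (fun _ x => Tm.var (r _ x)) τ = fun _ x => Tm.var (r.lift τ _ x) := by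
  funext σ x
  cases x <;> rfl

theorem Tm.ren_eq_sub {Γ Δ : Ctx} (r : Ren Γ Δ) {σ : Ty} (t : Tm Γ σ) :
    t.ren r = t.sub (fun _ x => .var (r _ x)) := by
  induction t with
  | var x => rfl
  | cst c => rfl
  | app s t hs ht => simp only [Tm.ren, Tm.sub, hs, ht]

theorem Fm.ren_eq_sub {Γ : Ctx} (A : Fm Γ) : ∀ {Δ : Ctx} (r : Ren Γ Δ),
    A.ren r = A.sub (fun _ x => .var (r _ x)) := by
  induction A with
  | eq s t => intro Δ r; simp only [Fm.ren, Fm.sub, Tm.ren_eq_sub]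
  | lt s t => intro Δ r; simp only [Fm.ren, Fm.sub, Tm.ren_eq_sub]
  | bot => intro Δ r; rfl
  | and A B hA hB => intro Δ r; simp only [Fm.ren, Fm.sub, hA, hB]
  | or A B hA hB => intro Δ r; simp only [Fm.ren, Fm.sub, hA, hB]
  | imp A B hA hB => intro Δ r; simp only [Fm.ren, Fm.sub, hA, hB]
  | all σ A hA => intro Δ r; simp only [Fm.ren, Fm.sub, hA, Ren.lift_toSub]
  | ex σ A hA => intro Δ r; simp only [Fm.ren, Fm.sub, hA, Ren.lift_toSub]

theorem Tm.sub_sub {Γ Δ Θ : Ctx} (θ : Sub Γ Δ) (η : Sub Δ Θ) {σ : Ty} (t : Tm Γ σ) :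
    (t.sub θ).sub η = t.sub (fun _ x => (θ _ x).sub η) := by
  induction t with
  | var x => rfl
  | cst c => rfl
  | app s t hs ht => simp only [Tm.sub, hs, ht]

theorem Tm.wk_eq_sub {Γ : Ctx} {σ : Ty} (τ : Ty) (t : Tm Γ σ) :
    t.wk τ = t.sub (fun _ x => .var (.s x)) := t.ren_eq_sub _

theorem Fm.wk_eq_sub {Γ : Ctx} (τ : Ty) (A : Fm Γ) :
    A.wk τ = A.sub (fun _ x => .var (.s x)) := A.ren_eq_sub _

theorem Tm.sub_wk {Γ Δ : Ctx} (θ : Sub Γ Δ) {σ : Ty} (τ : Ty) (t : Tm Γ σ) :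
    (t.sub θ).wk τ = t.sub (fun _ x => (θ _ x).wk τ) := by
  simp only [Tm.wk_eq_sub, Tm.sub_sub]

theorem Tm.wk_sub_lift {Γ Δ : Ctx} (θ : Sub Γ Δ) {σ : Ty} (τ : Ty) (t : Tm Γ σ) :
    (t.wk τ).sub (θ.lift τ) = (t.sub θ).wk τ := by
  rw [Tm.wk_eq_sub, Tm.sub_sub, Tm.sub_wk]
  rfl

theorem Sub.lift_comp {Γ Δ Θ : Ctx} (θ : Sub Γ Δ) (η : Sub Δ Θ) (τ : Ty) :
    (fun _ x => (θ.lift τ _ x).sub (η.lift τ) : Sub (τ :: Γ) (τ :: Θ)) =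
      Sub.lift (fun _ x => (θ _ x).sub η) τ := by
  funext σ x
  cases x with
  | z => rfl
  | s x => exact Tm.wk_sub_lift η τ (θ _ x)

theorem Fm.sub_sub {Γ : Ctx} (A : Fm Γ) : ∀ {Δ Θ : Ctx} (θ : Sub Γ Δ) (η : Sub Δ Θ),
    (A.sub θ).sub η = A.sub (fun _ x => (θ _ x).sub η) := by
  induction A with
  | eq s t => intro Δ Θ θ η; simp only [Fm.sub, Tm.sub_sub]
  | lt s t => intro Δ Θ θ η; simp only [Fm.sub, Tm.sub_sub]
  | bot => intro Δ Θ θ η; rfl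
  | and A B hA hB => intro Δ Θ θ η; simp only [Fm.sub, hA, hB]
  | or A B hA hB => intro Δ Θ θ η; simp only [Fm.sub, hA, hB]
  | imp A B hA hB => intro Δ Θ θ η; simp only [Fm.sub, hA, hB]
  | all σ A hA => intro Δ Θ θ η; simp only [Fm.sub, hA, Sub.lift_comp]
  | ex σ A hA => intro Δ Θ θ η; simp only [Fm.sub, hA, Sub.lift_comp]

theorem Sub.lift_var {Γ : Ctx} (τ : Ty) :
    Sub.lift (fun _ x => Tm.var x : Sub Γ Γ) τ = fun _ x => .var x := by
  funext σ x
  cases x <;> rfl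

theorem Tm.sub_var {Γ : Ctx} {σ : Ty} (t : Tm Γ σ) : t.sub (fun _ x => .var x) = t := by
  induction t with
  | var x => rfl
  | cst c => rfl
  | app s t hs ht => simp only [Tm.sub, hs, ht]

theorem Fm.sub_var {Γ : Ctx} (A : Fm Γ) : A.sub (fun _ x => .var x) = A := by
  induction A with
  | eq s t => simp only [Fm.sub, Tm.sub_var]
  | lt s t => simp only [Fm.sub, Tm.sub_var]
  | bot => rfl
  | and A B hA hB => simp only [Fm.sub, hA, hB]
  | or A B hA hB => simp only [Fm.sub, hA, hB]
  | imp A B hA hB => simp only [Fm.sub, hA, hB]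
  | all σ A hA => simp only [Fm.sub, Sub.lift_var, hA]
  | ex σ A hA => simp only [Fm.sub, Sub.lift_var, hA]

/-- Extend a substitution by a term for the variable `0`. -/
def Sub.cons {Γ Δ : Ctx} {τ : Ty} (t : Tm Δ τ) (θ : Sub Γ Δ) : Sub (τ :: Γ) Δ
  | _, .z => t
  | _, .s x => θ _ x

theorem Tm.wk_sub_single {Γ : Ctx} {σ τ : Ty} (s : Tm Γ σ) (t : Tm Γ τ) :
    (s.wk τ).sub (Sub.single t) = s := by
  rw [Tm.wk_eq_sub, Tm.sub_sub]
  exact Tm.sub_var s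

theorem Fm.sub_lift_inst {Γ Δ : Ctx} {τ : Ty} (A : Fm (τ :: Γ)) (θ : Sub Γ Δ) (t : Tm Δ τ) :
    (A.sub (θ.lift τ)).inst t = A.sub (Sub.cons t θ) := by
  unfold Fm.inst
  rw [Fm.sub_sub]
  congr 1
  funext σ x
  cases x with
  | z => rfl
  | s x => exact Tm.wk_sub_single _ t

theorem Fm.inst_sub {Γ Δ : Ctx} {τ : Ty} (A : Fm (τ :: Γ)) (t : Tm Γ τ) (θ : Sub Γ Δ) :
    (A.inst t).sub θ = (A.sub (θ.lift τ)).inst (t.sub θ) := by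
  rw [Fm.sub_lift_inst]
  unfold Fm.inst
  rw [Fm.sub_sub]
  congr 1
  funext σ x
  cases x <;> rfl

theorem Fm.sub_lift_self_inst {Γ Δ : Ctx} {τ : Ty} (A : Fm (τ :: Γ)) (θ : Sub Γ Δ) :
    A.sub (Sub.cons v0 (fun _ x => (θ _ x).wk τ)) = A.sub (θ.lift τ) := by
  congr 1

theorem Fm.sub_wk {Γ Δ : Ctx} (A : Fm Γ) (θ : Sub Γ Δ) (τ : Ty) :
    (A.sub θ).wk τ = A.sub (fun _ x => (θ _ x).wk τ) := by
  rw [Fm.wk_eq_sub, Fm.sub_sub]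
  congr 1
  funext σ x
  rw [Tm.wk_eq_sub]

theorem Fm.wk_sub_lift {Γ Δ : Ctx} (A : Fm Γ) (θ : Sub Γ Δ) (τ : Ty) :
    (A.wk τ).sub (θ.lift τ) = (A.sub θ).wk τ := by
  rw [Fm.sub_wk, Fm.wk_eq_sub, Fm.sub_sub]
  rfl

theorem Fm.wk_inst {Γ : Ctx} {τ : Ty} (A : Fm Γ) (t : Tm Γ τ) : (A.wk τ).inst t = A := by
  unfold Fm.inst
  rw [Fm.wk_eq_sub, Fm.sub_sub]
  exact A.sub_var

theorem eqT_sub {Γ Δ : Ctx} {τ : Ty} (s t : Tm Γ τ) (θ : Sub Γ Δ) :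
    (eqT τ s t).sub θ = eqT τ (s.sub θ) (t.sub θ) := by
  induction τ generalizing Γ Δ with
  | o => rfl
  | arr σ τ _ ih =>
    simp only [eqT, Fm.sub, ih, Tm.sub, Tm.wk_sub_lift]
    rfl

theorem Fm.QF.sub {Γ : Ctx} {A : Fm Γ} : A.QF → ∀ {Δ : Ctx} (θ : Sub Γ Δ), (A.sub θ).QF := by
  induction A with
  | eq s t => intros; trivial
  | lt s t => intros; trivial
  | bot => intros; trivial
  | and A B hA hB => exact fun h _ θ => ⟨hA h.1 θ, hB h.2 θ⟩
  | or A B hA hB => exact fun h _ θ => ⟨hA h.1 θ, hB h.2 θ⟩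
  | imp A B hA hB => exact fun h _ θ => ⟨hA h.1 θ, hB h.2 θ⟩
  | all σ A hA => exact fun h => h.elim
  | ex σ A hA => exact fun h => h.elim

theorem choiceSub_lift {Γ Δ : Ctx} (θ : Sub Γ Δ) (σ τ : Ty) (A : Fm (τ :: σ :: Γ)) :
    (A.sub (choiceSub Γ σ τ)).sub ((θ.lift (σ ⇒ τ)).lift σ) =
      (A.sub ((θ.lift σ).lift τ)).sub (choiceSub Δ σ τ) := by
  simp only [Fm.sub_sub]
  congr 1
  funext ρ x
  cases x with
  | z => rfl
  | s x =>
    cases x with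
    | z => rfl
    | s x =>
      simp only [Sub.lift, choiceSub, Tm.sub, Tm.wk_eq_sub, Tm.sub_sub]

theorem succSub_lift {Γ Δ : Ctx} (θ : Sub Γ Δ) (A : Fm (T0 :: Γ)) :
    (A.sub (succSub Γ)).sub (θ.lift T0) = (A.sub (θ.lift T0)).sub (succSub Δ) := by
  simp only [Fm.sub_sub]
  congr 1
  funext ρ x
  cases x with
  | z => rfl
  | s x => simp only [Sub.lift, succSub, Tm.sub, Tm.wk_eq_sub, Tm.sub_sub]

theorem QFAC.sub {σ τ : Ty} {Γ Δ : Ctx} {A : Fm Γ} (h : A ∈ QFAC σ τ Γ) (θ : Sub Γ Δ) :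
    A.sub θ ∈ QFAC σ τ Δ := by
  obtain ⟨A, hA⟩ := h
  simp only [Fm.sub, choiceSub_lift]
  exact QFAC.intro _ (hA.sub _)

/-- Closure under substitution lets a derivation be carried along when the Henkin construction
enlarges the context. Only the schemata with binders need an argument, namely that `succSub` and
`choiceSub` commute with lifted substitutions. -/
theorem RCA.sub {Γ Δ : Ctx} {A : Fm Γ} (h : A ∈ RCA Γ) (θ : Sub Γ Δ) : A.sub θ ∈ RCA Δ := by
  cases h with
  | eq_refl a => exact RCA.eq_refl _
  | eq_symm a b => exact RCA.eq_symm _ _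
  | eq_trans a b c => exact RCA.eq_trans _ _ _
  | lt_congr a b c d => exact RCA.lt_congr _ _ _ _
  | add_assoc a b c => exact RCA.add_assoc _ _ _
  | add_comm a b => exact RCA.add_comm _ _
  | add_zero a => exact RCA.add_zero _
  | mul_assoc a b c => exact RCA.mul_assoc _ _ _
  | mul_comm a b => exact RCA.mul_comm _ _
  | mul_one a => exact RCA.mul_one _
  | mul_zero a => exact RCA.mul_zero _
  | mul_add a b c => exact RCA.mul_add _ _ _
  | lt_irrefl a => exact RCA.lt_irrefl _
  | lt_trans a b c => exact RCA.lt_trans _ _ _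
  | lt_total a b => exact RCA.lt_total _ _
  | add_lt_add a b c => exact RCA.add_lt_add _ _ _
  | mul_lt_mul a b c => exact RCA.mul_lt_mul _ _ _
  | zero_lt_one => exact RCA.zero_lt_one
  | zero_le a => exact RCA.zero_le _
  | discrete a b => exact RCA.discrete _ _
  | k_ax x y => rw [eqT_sub]; exact RCA.k_ax _ _
  | s_ax x y w => rw [eqT_sub]; exact RCA.s_ax _ _ _
  | rec_zero f m => exact RCA.rec_zero _ _
  | rec_succ f m n => exact RCA.rec_succ _ _ _
  | ext x y φ => simp only [Fm.sub, eqT_sub]; exact RCA.ext _ _ _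
  | ind A hA =>
    simp only [Fm.sub, Fm.inst_sub, succSub_lift]
    exact RCA.ind _ (hA.sub _)
  | qfac A hA => exact RCA.qfac _ (QFAC.sub hA θ)

theorem RCAQFAC20.sub {Γ Δ : Ctx} {A : Fm Γ} (h : A ∈ RCAQFAC20 Γ) (θ : Sub Γ Δ) :
    A.sub θ ∈ RCAQFAC20 Δ :=
  h.elim (fun h => Or.inl (RCA.sub h θ)) (fun h => Or.inr (QFAC.sub h θ))

/-! Structural properties of derivations. -/

theorem Prf.mono {T : Theory} {Γ : Ctx} {H : List (Fm Γ)} {A : Fm Γ} (h : Prf T H A) :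
    ∀ {H' : List (Fm Γ)}, H ⊆ H' → Prf T H' A := by
  induction h with
  | ax h => exact fun _ => .ax h
  | hyp h => exact fun hs => .hyp (hs h)
  | impI _ ih => exact fun hs => .impI (ih (List.cons_subset_cons _ hs))
  | impE _ _ ih₁ ih₂ => exact fun hs => .impE (ih₁ hs) (ih₂ hs)
  | andI _ _ ih₁ ih₂ => exact fun hs => .andI (ih₁ hs) (ih₂ hs)
  | andL _ ih => exact fun hs => .andL (ih hs)
  | andR _ ih => exact fun hs => .andR (ih hs)
  | orL _ ih => exact fun hs => .orL (ih hs)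
  | orR _ ih => exact fun hs => .orR (ih hs)
  | orE _ _ _ ih ih₁ ih₂ =>
    exact fun hs => .orE (ih hs) (ih₁ (List.cons_subset_cons _ hs))
      (ih₂ (List.cons_subset_cons _ hs))
  | raa _ ih => exact fun hs => .raa (ih (List.cons_subset_cons _ hs))
  | allI _ ih => exact fun hs => .allI (ih (List.map_subset _ hs))
  | allE t _ ih => exact fun hs => .allE t (ih hs)
  | exI t _ ih => exact fun hs => .exI t (ih hs)
  | exE _ _ ih₁ ih₂ =>
    exact fun hs => .exE (ih₁ hs) (ih₂ (List.cons_subset_cons _ (List.map_subset _ hs)))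

theorem map_wk_map_sub {Γ Δ : Ctx} (H : List (Fm Γ)) (θ : Sub Γ Δ) (σ : Ty) :
    (H.map (Fm.wk σ)).map (Fm.sub (θ.lift σ)) = (H.map (Fm.sub θ)).map (Fm.wk σ) := by
  simp only [List.map_map]
  exact List.map_congr_left fun A _ => A.wk_sub_lift θ σ

theorem Prf.sub {T : Theory}
    (hT : ∀ {Γ Δ : Ctx} {A : Fm Γ} (θ : Sub Γ Δ), A ∈ T Γ → A.sub θ ∈ T Δ)
    {Γ : Ctx} {H : List (Fm Γ)} {A : Fm Γ} (h : Prf T H A) :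
    ∀ {Δ : Ctx} (θ : Sub Γ Δ), Prf T (H.map (Fm.sub θ)) (A.sub θ) := by
  induction h with
  | ax h => exact fun θ => .ax (hT θ h)
  | hyp h => exact fun θ => .hyp (List.mem_map_of_mem h)
  | impI _ ih => exact fun θ => .impI (ih θ)
  | impE _ _ ih₁ ih₂ => exact fun θ => .impE (ih₁ θ) (ih₂ θ)
  | andI _ _ ih₁ ih₂ => exact fun θ => .andI (ih₁ θ) (ih₂ θ)
  | andL _ ih => exact fun θ => .andL (ih θ)
  | andR _ ih => exact fun θ => .andR (ih θ)
  | orL _ ih => exact fun θ => .orL (ih θ)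
  | orR _ ih => exact fun θ => .orR (ih θ)
  | orE _ _ _ ih ih₁ ih₂ => exact fun θ => .orE (ih θ) (ih₁ θ) (ih₂ θ)
  | raa _ ih => exact fun θ => .raa (ih θ)
  | allI _ ih =>
    intro Δ θ
    refine .allI ?_
    rw [← map_wk_map_sub]
    exact ih _
  | allE t _ ih =>
    intro Δ θ
    rw [Fm.inst_sub]
    exact .allE _ (ih θ)
  | exI t _ ih =>
    intro Δ θ
    refine .exI (t.sub θ) ?_
    rw [← Fm.inst_sub]
    exact ih θ
  | exE _ _ ih₁ ih₂ =>
    intro Δ θ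
    refine .exE (ih₁ θ) ?_
    rw [← map_wk_map_sub, ← Fm.wk_sub_lift]
    exact ih₂ _

theorem Prf.wk {T : Theory}
    (hT : ∀ {Γ Δ : Ctx} {A : Fm Γ} (θ : Sub Γ Δ), A ∈ T Γ → A.sub θ ∈ T Δ)
    {Γ : Ctx} {H : List (Fm Γ)} {A : Fm Γ} (h : Prf T H A) (τ : Ty) :
    Prf T (H.map (Fm.wk τ)) (A.wk τ) := by
  have := h.sub hT (fun _ x => (.var (.s x) : Tm (τ :: Γ) _))
  rw [Fm.wk_eq_sub, show (Fm.wk τ : Fm Γ → _) = Fm.sub (fun _ x => .var (.s x)) from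
    funext fun A => A.wk_eq_sub τ]
  exact this

/-! Countability of the syntax. -/

def Ty.depth : Ty → ℕ
  | .o => 0
  | .arr σ τ => max σ.depth τ.depth + 1

instance : Countable Ty := by
  have key : ∀ n : ℕ, {σ : Ty | σ.depth < n}.Countable := by
    intro n
    induction n with
    | zero => simp
    | succ n ih =>
      refine ((Set.countable_singleton Ty.o).union (ih.image2 ih Ty.arr)).mono ?_
      rintro (_ | ⟨σ, τ⟩) h
      · exact Or.inl rfl
      · simp only [Ty.depth, Set.mem_ofPred_eq] at h
        exact Or.inr ⟨σ, by simp; omega, τ, by simp; omega, rfl⟩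
  rw [← Set.countable_univ_iff]
  exact (Set.countable_iUnion key).mono fun σ _ =>
    Set.mem_iUnion.2 ⟨σ.depth + 1, Nat.lt_succ_self _⟩

/-- Closed terms with parameters `par k` of every type. -/
inductive PTm : Ty → Type
  | par {σ : Ty} : ℕ → PTm σ
  | cst {σ : Ty} : Cst σ → PTm σ
  | app {σ τ : Ty} : PTm (σ ⇒ τ) → PTm σ → PTm τ

instance (σ : Ty) : Countable (Cst σ) := by
  let code : Cst σ → ℕ × Ty × Ty × Ty := fun c => match c with
    | .zero => (0, .o, .o, .o)
    | .one => (1, .o, .o, .o)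
    | .add => (2, .o, .o, .o)
    | .mul => (3, .o, .o, .o)
    | .K σ τ => (4, σ, τ, .o)
    | .S ρ σ τ => (5, ρ, σ, τ)
    | .R σ => (6, σ, .o, .o)
  have : Function.Injective code := by
    intro c d h
    cases c <;> cases d <;> first | rfl | simp_all [code]
  exact this.countable

/-- Subterms and subformulas live at other indices, so each depth level must be shown countable at
all indices simultaneously. Countability is what allows a Henkin construction in ω stages. -/
theorem countable_of_depth {ι : Type} {X : ι → Type} (d : ∀ i, X i → ℕ)
    (h : ∀ n, (∀ i, {x : X i | d i x < n}.Countable) → ∀ i, {x : X i | d i x < n + 1}.Countable)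
    (i : ι) : Countable (X i) := by
  have key : ∀ n i, {x : X i | d i x < n}.Countable := by
    intro n
    induction n with
    | zero => simp
    | succ n ih => exact h n ih
  rw [← Set.countable_univ_iff]
  exact (Set.countable_iUnion fun n => key n i).mono fun x _ =>
    Set.mem_iUnion.2 ⟨d i x + 1, Nat.lt_succ_self _⟩

def PTm.depth : (σ : Ty) → PTm σ → ℕ
  | _, .par _ => 0
  | _, .cst _ => 0
  | _, .app s t => max (s.depth _) (t.depth _) + 1

instance (σ : Ty) : Countable (PTm σ) := by
  refine countable_of_depth PTm.depth (fun n ih σ => ?_) σ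
  refine (((Set.countable_range (PTm.par (σ := σ))).union
    (Set.countable_range (PTm.cst (σ := σ)))).union
    (Set.countable_iUnion fun ρ => (ih (ρ ⇒ σ)).image2 (ih ρ) PTm.app)).mono ?_
  rintro (k | c | ⟨s, t⟩) h
  · exact Or.inl (Or.inl ⟨k, rfl⟩)
  · exact Or.inl (Or.inr ⟨c, rfl⟩)
  · simp only [PTm.depth, Set.mem_ofPred_eq] at h
    exact Or.inr (Set.mem_iUnion.2 ⟨_, s, by simp; omega, t, by simp; omega, rfl⟩)

theorem countable_var (Γ : Ctx) : ∀ σ, Countable (Var Γ σ) := by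
  induction Γ with
  | nil => exact fun σ => ⟨fun _ => 0, fun x => by cases x⟩
  | cons τ Γ ih =>
    intro σ
    have := ih σ
    refine Function.Injective.countable (β := Option (Var Γ σ))
      (f := fun x => match x with | .z => none | .s y => some y) ?_
    intro x y h
    cases x <;> cases y <;> simp_all

instance (Γ : Ctx) (σ : Ty) : Countable (Var Γ σ) := countable_var Γ σ

def Tm.depth {Γ : Ctx} : (σ : Ty) → Tm Γ σ → ℕ
  | _, .var _ => 0
  | _, .cst _ => 0
  | _, .app s t => max (s.depth _) (t.depth _) + 1

instance (Γ : Ctx) (σ : Ty) : Countable (Tm Γ σ) := by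
  refine countable_of_depth Tm.depth (fun n ih σ => ?_) σ
  refine (((Set.countable_range (Tm.var (Γ := Γ) (σ := σ))).union
    (Set.countable_range (Tm.cst (σ := σ)))).union
    (Set.countable_iUnion fun ρ => (ih (ρ ⇒ σ)).image2 (ih ρ) Tm.app)).mono ?_
  rintro (k | c | ⟨s, t⟩) h
  · exact Or.inl (Or.inl ⟨k, rfl⟩)
  · exact Or.inl (Or.inr ⟨c, rfl⟩)
  · simp only [Tm.depth, Set.mem_ofPred_eq] at h
    exact Or.inr (Set.mem_iUnion.2 ⟨_, s, by simp; omega, t, by simp; omega, rfl⟩)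

def Fm.depth : (Γ : Ctx) → Fm Γ → ℕ
  | _, .eq _ _ => 0
  | _, .lt _ _ => 0
  | _, .bot => 0
  | _, .and A B => max (A.depth _) (B.depth _) + 1
  | _, .or A B => max (A.depth _) (B.depth _) + 1
  | _, .imp A B => max (A.depth _) (B.depth _) + 1
  | _, .all _ A => A.depth _ + 1
  | _, .ex _ A => A.depth _ + 1

instance (Γ : Ctx) : Countable (Fm Γ) := by
  refine countable_of_depth Fm.depth (fun n ih Γ => ?_) Γ
  refine ((((Set.countable_range fun p : Tm Γ T0 × Tm Γ T0 => Fm.eq p.1 p.2).union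
    (Set.countable_range fun p : Tm Γ T0 × Tm Γ T0 => Fm.lt p.1 p.2)).union
    (Set.countable_singleton Fm.bot)).union
    ((((ih Γ).image2 (ih Γ) Fm.and).union ((ih Γ).image2 (ih Γ) Fm.or)).union
      ((ih Γ).image2 (ih Γ) Fm.imp)) |>.union
    ((Set.countable_iUnion fun σ => (ih (σ :: Γ)).image (Fm.all σ)).union
      (Set.countable_iUnion fun σ => (ih (σ :: Γ)).image (Fm.ex σ)))).mono ?_
  intro A h
  cases A with
  | eq s t => exact Or.inl (Or.inl (Or.inl (Or.inl ⟨(s, t), rfl⟩)))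
  | lt s t => exact Or.inl (Or.inl (Or.inl (Or.inr ⟨(s, t), rfl⟩)))
  | bot => exact Or.inl (Or.inl (Or.inr rfl))
  | and A B =>
    simp only [Fm.depth, Set.mem_ofPred_eq] at h
    exact Or.inl (Or.inr (Or.inl (Or.inl ⟨A, by simp; omega, B, by simp; omega, rfl⟩)))
  | or A B =>
    simp only [Fm.depth, Set.mem_ofPred_eq] at h
    exact Or.inl (Or.inr (Or.inl (Or.inr ⟨A, by simp; omega, B, by simp; omega, rfl⟩)))
  | imp A B =>
    simp only [Fm.depth, Set.mem_ofPred_eq] at h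
    exact Or.inl (Or.inr (Or.inr ⟨A, by simp; omega, B, by simp; omega, rfl⟩))
  | all σ A =>
    simp only [Fm.depth, Set.mem_ofPred_eq] at h
    exact Or.inr (Or.inl (Set.mem_iUnion.2 ⟨σ, A, by simp; omega, rfl⟩))
  | ex σ A =>
    simp only [Fm.depth, Set.mem_ofPred_eq] at h
    exact Or.inr (Or.inr (Set.mem_iUnion.2 ⟨σ, A, by simp; omega, rfl⟩))

abbrev PEnv (Γ : Ctx) : Type := ∀ σ, Var Γ σ → PTm σ

theorem countable_pEnv (Γ : Ctx) : Countable (PEnv Γ) := by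
  induction Γ with
  | nil =>
    refine ⟨fun _ => 0, fun θ η _ => ?_⟩
    funext σ x
    cases x
  | cons τ Γ ih =>
    refine Function.Injective.countable (β := PTm τ × PEnv Γ)
      (f := fun θ => (θ τ .z, fun σ x => θ σ (.s x))) ?_
    intro θ η h
    simp only [Prod.mk.injEq] at h
    funext σ x
    cases x with
    | z => exact h.1
    | s x => exact congrFun (congrFun h.2 σ) x

instance (Γ : Ctx) : Countable (PEnv Γ) := countable_pEnv Γ

/-! ### The Henkin construction. -/

/-- A formula with a distinguished variable and parameters for the other variables. -/
abbrev Task : Type := Σ Γ : Ctx, Σ σ : Ty, Fm (σ :: Γ) × PEnv Γ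

instance : Nonempty Task := ⟨⟨[], .o, .bot, fun _ x => by cases x⟩⟩

/-- A task is only useful at a stage where its parameters have received their final values, hence
each one has to recur infinitely often. -/
theorem exists_task_enum : ∃ e : ℕ → Task, ∀ t, ∃ᶠ m in atTop, e m = t := by
  obtain ⟨f, hf⟩ := exists_surjective_nat Task
  refine ⟨fun m => f m.unpair.1, fun t => ?_⟩
  obtain ⟨k, rfl⟩ := hf t
  refine frequently_atTop.2 fun a => ⟨Nat.pair k a, Nat.right_le_pair k a, ?_⟩
  simp

/-- A closed term of each type. -/
def dflt {Γ : Ctx} : (σ : Ty) → Tm Γ σ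
  | .o => zero
  | .arr σ τ => kk τ σ ⬝ dflt τ

def Con (T : Theory) {Γ : Ctx} (H : List (Fm Γ)) : Prop := ¬Prf T H .bot

/-- The context at stage `m` of the Henkin construction. -/
def hctx (e : ℕ → Task) : ℕ → Ctx
  | 0 => []
  | m + 1 => (e m).2.1 :: hctx e m

open Classical in
/-- The value at stage `m` of the parameter `k`. -/
noncomputable def pvar (e : ℕ → Task) : (m k : ℕ) → (σ : Ty) → Tm (hctx e m) σ
  | 0, _, σ => dflt σ
  | m + 1, k, σ =>
    if k = m then (if h : (e m).2.1 = σ then h ▸ (v0 : Tm ((e m).2.1 :: hctx e m) (e m).2.1)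
      else dflt σ)
    else (pvar e m k σ).wk _

noncomputable def PTm.down (e : ℕ → Task) (m : ℕ) : {σ : Ty} → PTm σ → Tm (hctx e m) σ
  | σ, .par k => pvar e m k σ
  | _, .cst c => .cst c
  | _, .app s t => .app (s.down e m) (t.down e m)

noncomputable abbrev PEnv.down (e : ℕ → Task) (m : ℕ) {Γ : Ctx} (θ : PEnv Γ) : Sub Γ (hctx e m) :=
  fun σ x => (θ σ x).down e m

/-- The formula treated at stage `m`. -/
noncomputable def taskFm (e : ℕ → Task) (m : ℕ) : Fm ((e m).2.1 :: hctx e m) :=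
  (e m).2.2.1.sub (Sub.lift (PEnv.down e m (e m).2.2.2) _)

open Classical in
/-- The hypotheses at stage `m`. -/
noncomputable def hyps (T : Theory) (φ : Sentence) (e : ℕ → Task) : (m : ℕ) → List (Fm (hctx e m))
  | 0 => [∼φ]
  | m + 1 =>
    if Con T (.ex _ (taskFm e m) :: hyps T φ e m) then
      taskFm e m :: (hyps T φ e m).map (Fm.wk _)
    else (hyps T φ e m).map (Fm.wk _)

theorem pvar_succ_self (e : ℕ → Task) (m : ℕ) :
    pvar e (m + 1) m (e m).2.1 = (v0 : Tm ((e m).2.1 :: hctx e m) (e m).2.1) :=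
  (if_pos rfl).trans (dif_pos rfl)

theorem pvar_succ_of_ne (e : ℕ → Task) {m k : ℕ} (h : k ≠ m) (σ : Ty) :
    (pvar e (m + 1) k σ : Tm ((e m).2.1 :: hctx e m) σ) = (pvar e m k σ).wk (e m).2.1 :=
  if_neg h

/-- The parameter `k` has a default value up to stage `k`, becomes the fresh variable at stage `k +
1` if the type fits, and from then on is only weakened. -/
theorem eventually_down_succ (e : ℕ → Task) {σ : Ty} (t : PTm σ) :
    ∀ᶠ m in atTop, t.down e (m + 1) = (t.down e m).wk (e m).2.1 := by
  induction t with
  | par k =>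
    filter_upwards [eventually_gt_atTop k] with m hm
    exact pvar_succ_of_ne e hm.ne _
  | cst c => exact Eventually.of_forall fun m => rfl
  | app s t hs ht =>
    filter_upwards [hs, ht] with m h₁ h₂
    simp only [PTm.down, h₁, h₂]
    rfl

theorem eventually_forall_var {Γ : Ctx} {p : ℕ → (σ : Ty) → Var Γ σ → Prop}
    (h : ∀ σ x, ∀ᶠ m in atTop, p m σ x) : ∀ᶠ m in atTop, ∀ σ x, p m σ x := by
  induction Γ with
  | nil => exact Eventually.of_forall fun m σ x => by cases x
  | cons τ Γ ih =>
    filter_upwards [h τ .z, ih (p := fun m σ x => p m σ (.s x)) fun σ x => h σ (.s x)]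
      with m h₁ h₂ σ x
    cases x with
    | z => exact h₁
    | s x => exact h₂ σ x

/-- The values of the parameters of `θ` do not change after stage `m`. -/
def StableAt (e : ℕ → Task) (m : ℕ) {Γ : Ctx} (θ : PEnv Γ) : Prop :=
  (θ.down e (m + 1) : Sub Γ ((e m).2.1 :: hctx e m)) = fun σ x => (θ.down e m σ x).wk (e m).2.1

theorem eventually_stableAt (e : ℕ → Task) {Γ : Ctx} (θ : PEnv Γ) :
    ∀ᶠ m in atTop, StableAt e m θ := by
  filter_upwards [eventually_forall_var fun σ x => eventually_down_succ e (θ σ x)] with m h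
  funext σ x
  exact h σ x

section
variable {T : Theory} {φ : Sentence} {e : ℕ → Task}

theorem Con.ex_elim {Γ : Ctx} {H : List (Fm Γ)} {σ : Ty} {A : Fm (σ :: Γ)}
    (h : Con T (.ex σ A :: H)) : Con T (A :: H.map (Fm.wk σ)) := fun hp =>
  h (.exE (.hyp (List.mem_cons_self)) (hp.mono
    (List.cons_subset_cons _ (List.map_subset _ (List.subset_cons_self _ _)))))

/-- A fresh variable creates no inconsistency because every type has a closed term to put in its
place. -/
theorem Con.map_wk {Γ : Ctx} {H : List (Fm Γ)} (h : Con T H) (σ : Ty) :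
    Con T (H.map (Fm.wk σ)) := fun hp =>
  h (Prf.allE (A := .bot) (dflt σ) (.allI hp))

open Classical in
theorem hyps_succ_eq (m : ℕ) :
    (hyps T φ e (m + 1) : List (Fm ((e m).2.1 :: hctx e m))) =
      if Con T (.ex _ (taskFm e m) :: hyps T φ e m) then
        taskFm e m :: (hyps T φ e m).map (Fm.wk _)
      else (hyps T φ e m).map (Fm.wk _) := rfl

theorem con_hyps (hφ : ¬T.Proves φ) (m : ℕ) : Con T (hyps T φ e m) := by
  induction m with
  | zero => exact fun h => hφ (.raa h)
  | succ m ih =>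
    rw [hyps_succ_eq]
    split_ifs with h
    · exact h.ex_elim
    · exact ih.map_wk _

theorem hyps_succ (m : ℕ) :
    (hyps T φ e m).map (Fm.wk _) ⊆ (hyps T φ e (m + 1) : List (Fm ((e m).2.1 :: hctx e m))) := by
  rw [hyps_succ_eq]
  split_ifs
  · exact List.subset_cons_self _ _
  · exact List.Subset.refl _

/-- Truth in the Henkin theory of a formula with parameters. -/
def Tr (T : Theory) (φ : Sentence) (e : ℕ → Task) {Γ : Ctx} (A : Fm Γ) (θ : PEnv Γ) : Prop :=
  ∀ᶠ m in atTop, Prf T (hyps T φ e m) (A.sub (θ.down e m))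

/-- Extend an assignment of parameters. -/
def PEnv.cons {Γ : Ctx} {τ : Ty} (t : PTm τ) (θ : PEnv Γ) : PEnv (τ :: Γ)
  | _, .z => t
  | _, .s x => θ _ x

theorem PEnv.down_cons {Γ : Ctx} {τ : Ty} (t : PTm τ) (θ : PEnv Γ) (m : ℕ) :
    (PEnv.cons t θ).down e m = Sub.cons (t.down e m) (θ.down e m) := by
  funext σ x
  cases x <;> rfl

/-- If the existential formula is inconsistent with the hypotheses, its negation is derivable;
otherwise its matrix becomes a hypothesis about the fresh variable. Stability identifies that matrix
with the formula evaluated one stage later. -/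
theorem task_decided (m : ℕ) (hs : StableAt e m (e m).2.2.2) :
    Prf T (hyps T φ e m) (∼.ex _ ((e m).2.2.1.sub (Sub.lift (PEnv.down e m (e m).2.2.2) _))) ∨
      Prf T (hyps T φ e (m + 1))
        ((e m).2.2.1.sub ((PEnv.cons (.par m) (e m).2.2.2).down e (m + 1))) := by
  by_cases h : Con T (.ex _ (taskFm e m) :: hyps T φ e m)
  · right
    have key : taskFm e m ∈ (hyps T φ e (m + 1) : List (Fm ((e m).2.1 :: hctx e m))) := by
      rw [hyps_succ_eq, if_pos h]
      exact List.mem_cons_self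
    have hp : Prf T (hyps T φ e (m + 1) : List (Fm ((e m).2.1 :: hctx e m))) (taskFm e m) :=
      .hyp key
    rw [PEnv.down_cons, hs]
    unfold taskFm at hp
    rw [← Fm.sub_lift_self_inst, ← pvar_succ_self] at hp
    exact hp
  · exact Or.inl (.impI (not_not.1 h))

theorem exists_task (he : ∀ t, ∃ᶠ m in atTop, e m = t) {Γ : Ctx} {σ : Ty} (A : Fm (σ :: Γ))
    (θ : PEnv Γ) : ∃ᶠ m in atTop,
      Prf T (hyps T φ e m) (∼.ex σ (A.sub ((θ.down e m).lift σ))) ∨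
      Prf T (hyps T φ e (m + 1)) (A.sub ((PEnv.cons (.par m) θ).down e (m + 1))) := by
  refine ((he ⟨Γ, σ, A, θ⟩).and_eventually (eventually_stableAt e θ)).mono ?_
  rintro m ⟨hm, hs⟩
  have := task_decided (T := T) (φ := φ) (e := e) m
  rw [hm] at this
  exact this hs

variable (hT : ∀ {Γ Δ : Ctx} {A : Fm Γ} (θ : Sub Γ Δ), A ∈ T Γ → A.sub θ ∈ T Δ)
include hT

/-- Hypotheses are only added, so a derivation at one stage survives by weakening once the
parameters have settled. -/
theorem tr_of_stable {Γ : Ctx} {A : Fm Γ} {θ : PEnv Γ} {m : ℕ} (hs : ∀ k ≥ m, StableAt e k θ)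
    (h : Prf T (hyps T φ e m) (A.sub (θ.down e m))) : Tr T φ e A θ := by
  refine eventually_atTop.2 ⟨m, fun k hk => ?_⟩
  induction k, hk using Nat.le_induction with
  | base => exact h
  | succ k hk ih =>
    have := (ih.wk hT (e k).2.1).mono (hyps_succ k)
    rw [Fm.sub_wk, ← hs k hk] at this
    exact this

theorem tr_of_frequently {Γ : Ctx} {A : Fm Γ} {θ : PEnv Γ}
    (h : ∃ᶠ m in atTop, Prf T (hyps T φ e m) (A.sub (θ.down e m))) : Tr T φ e A θ := by
  obtain ⟨a, ha⟩ := eventually_atTop.1 (eventually_stableAt e θ)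
  obtain ⟨m, hm, h⟩ := frequently_atTop.1 h a
  exact tr_of_stable hT (fun k hk => ha k (hm.trans hk)) h

/-- The Henkin step also completes the theory: it is applied to a vacuous quantification of `A`, so
no separate maximal extension is needed. -/
theorem tr_em (he : ∀ t, ∃ᶠ m in atTop, e m = t) {Γ : Ctx} (A : Fm Γ) (θ : PEnv Γ) :
    Tr T φ e A θ ∨ Tr T φ e (∼A) θ := by
  rcases frequently_or_distrib.1 (exists_task he (T := T) (φ := φ) (A.wk T0) θ) with h | h
  · right
    refine tr_of_frequently hT (h.mono fun m h => ?_)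
    rw [Fm.wk_sub_lift] at h
    refine .impI (.impE (h.mono (List.subset_cons_self _ _)) (.exI (dflt T0) ?_))
    rw [Fm.wk_inst]
    exact .hyp List.mem_cons_self
  · left
    refine tr_of_frequently hT ((tendsto_add_atTop_nat 1).frequently (h.mono fun m h => ?_))
    rw [Fm.wk_eq_sub, Fm.sub_sub] at h
    exact h

/-- Some late stage treats the task `A`. The negative outcome contradicts consistency, so the
parameter introduced there is a witness. -/
theorem tr_henkin (hφ : ¬T.Proves φ) (he : ∀ t, ∃ᶠ m in atTop, e m = t) {Γ : Ctx} {σ : Ty}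
    {A : Fm (σ :: Γ)} {θ : PEnv Γ} (h : Tr T φ e (.ex σ A) θ) :
    ∃ t : PTm σ, Tr T φ e A (PEnv.cons t θ) := by
  obtain ⟨a, ha⟩ := eventually_atTop.1 (eventually_stableAt e θ)
  obtain ⟨m, ⟨hm, h, hs⟩⟩ := ((exists_task he (T := T) (φ := φ) A θ).and_eventually
    (h.and (eventually_ge_atTop a))).exists
  refine ⟨.par m, ?_⟩
  rcases hm with hm | hm
  · exact (con_hyps hφ m (.impE hm h)).elim
  · refine tr_of_stable hT (fun k hk => ?_) hm
    have h₁ := ha k (by omega)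
    funext τ x
    cases x with
    | z => exact pvar_succ_of_ne e (by omega) _
    | s x => exact congrFun (congrFun h₁ τ) x

end

/-! Equality at all types. -/

section
variable {T : Theory} (hR : ∀ Γ, RCA Γ ⊆ T Γ)
include hR

theorem Prf.eqT_refl {τ : Ty} : ∀ {Γ : Ctx} {H : List (Fm Γ)} (s : Tm Γ τ),
    Prf T H (eqT τ s s) := by
  induction τ with
  | o => exact fun s => .ax (hR _ (RCA.eq_refl s))
  | arr σ τ _ ih => exact fun s => .allI (ih _)

omit hR in
theorem Prf.eqT_app {σ τ : Ty} {Γ : Ctx} {H : List (Fm Γ)} {s t : Tm Γ (σ ⇒ τ)}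
    (h : Prf T H (eqT (σ ⇒ τ) s t)) (u : Tm Γ σ) : Prf T H (eqT τ (s ⬝ u) (t ⬝ u)) := by
  have := Prf.allE u h
  unfold Fm.inst at this
  rw [eqT_sub] at this
  simp only [Tm.sub, Tm.wk_sub_single] at this
  exact this

variable (hT : ∀ {Γ Δ : Ctx} {A : Fm Γ} (θ : Sub Γ Δ), A ∈ T Γ → A.sub θ ∈ T Δ)

omit hR in
include hT in
theorem Prf.eqT_wk_app {σ τ : Ty} {Γ : Ctx} {H : List (Fm Γ)} {s t : Tm Γ (σ ⇒ τ)}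
    (h : Prf T H (eqT (σ ⇒ τ) s t)) :
    Prf T (H.map (Fm.wk σ)) (eqT τ (s.wk σ ⬝ v0) (t.wk σ ⬝ v0)) := by
  have := h.wk hT σ
  rw [Fm.wk_eq_sub, eqT_sub, ← Tm.wk_eq_sub, ← Tm.wk_eq_sub] at this
  exact this.eqT_app v0

include hT

theorem Prf.eqT_symm {τ : Ty} : ∀ {Γ : Ctx} {H : List (Fm Γ)} {s t : Tm Γ τ},
    Prf T H (eqT τ s t) → Prf T H (eqT τ t s) := by
  induction τ with
  | o => exact fun h => .impE (.ax (hR _ (RCA.eq_symm _ _))) h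
  | arr σ τ _ ih => exact fun h => .allI (ih (h.eqT_wk_app hT))

theorem Prf.eqT_trans {τ : Ty} : ∀ {Γ : Ctx} {H : List (Fm Γ)} {s t u : Tm Γ τ},
    Prf T H (eqT τ s t) → Prf T H (eqT τ t u) → Prf T H (eqT τ s u) := by
  induction τ with
  | o => exact fun h h' => .impE (.impE (.ax (hR _ (RCA.eq_trans _ _ _))) h) h'
  | arr σ τ _ ih => exact fun h h' => .allI (ih (h.eqT_wk_app hT) (h'.eqT_wk_app hT))

/-- This is where the extensionality axioms enter: they make application well defined on the
quotient by provable equality. -/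
theorem Prf.eqT_congr {σ τ : Ty} {Γ : Ctx} {H : List (Fm Γ)} {s s' : Tm Γ (σ ⇒ τ)} {t t' : Tm Γ σ}
    (h : Prf T H (eqT _ s s')) (h' : Prf T H (eqT _ t t')) :
    Prf T H (eqT τ (s ⬝ t) (s' ⬝ t')) :=
  .eqT_trans hR hT (.impE (.ax (hR _ (RCA.ext _ _ _))) h') (h.eqT_app t')

end

theorem Prf.ex_self {T : Theory} {Γ : Ctx} {σ : Ty} {H : List (Fm (σ :: Γ))} {A : Fm (σ :: Γ)}
    (h : Prf T H A) : Prf T H ((Fm.ex σ A).wk σ) := by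
  refine .exI v0 ?_
  rw [Fm.ren_eq_sub, ← Ren.lift_toSub, Fm.sub_lift_inst]
  convert h
  conv_rhs => rw [← A.sub_var]
  congr 1
  funext τ x
  cases x <;> rfl

/-! ### Structures, satisfaction and the term model. -/

/-- Structures for `L_ω`, with true equality at type `0`. -/
structure Model where
  M : Ty → Type
  app {σ τ : Ty} : M (σ ⇒ τ) → M σ → M τ
  cst {σ : Ty} : Cst σ → M σ
  lt : M T0 → M T0 → Prop

namespace Model
variable (𝔐 : Model)

abbrev VEnv (Γ : Ctx) : Type := ∀ σ, Var Γ σ → 𝔐.M σ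

variable {𝔐}

def VEnv.nil : 𝔐.VEnv [] := fun _ x => nomatch x

def VEnv.cons {Γ : Ctx} {τ : Ty} (a : 𝔐.M τ) (ρ : 𝔐.VEnv Γ) : 𝔐.VEnv (τ :: Γ)
  | _, .z => a
  | _, .s x => ρ _ x

def eval {Γ : Ctx} (ρ : 𝔐.VEnv Γ) : {σ : Ty} → Tm Γ σ → 𝔐.M σ
  | _, .var x => ρ _ x
  | _, .cst c => 𝔐.cst c
  | _, .app s t => 𝔐.app (eval ρ s) (eval ρ t)

def Sat : {Γ : Ctx} → 𝔐.VEnv Γ → Fm Γ → Prop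
  | _, ρ, .eq s t => eval ρ s = eval ρ t
  | _, ρ, .lt s t => 𝔐.lt (eval ρ s) (eval ρ t)
  | _, _, .bot => False
  | _, ρ, .and A B => Sat ρ A ∧ Sat ρ B
  | _, ρ, .or A B => Sat ρ A ∨ Sat ρ B
  | _, ρ, .imp A B => Sat ρ A → Sat ρ B
  | _, ρ, .all _ A => ∀ a, Sat (VEnv.cons a ρ) A
  | _, ρ, .ex _ A => ∃ a, Sat (VEnv.cons a ρ) A

end Model

/-- Extensional models of a theory. -/
structure ExtModel (T : Theory) extends Model where
  ext {σ τ : Ty} {f g : M (σ ⇒ τ)} : (∀ x, app f x = app g x) → f = g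
  sat {Γ : Ctx} {A : Fm Γ} : A ∈ T Γ → ∀ ρ : toModel.VEnv Γ, toModel.Sat ρ A

section
variable {T : Theory} (φ : Sentence) (e : ℕ → Task)
  (hT : ∀ {Γ Δ : Ctx} {A : Fm Γ} (θ : Sub Γ Δ), A ∈ T Γ → A.sub θ ∈ T Δ)
  (hR : ∀ Γ, RCA Γ ⊆ T Γ)

def pSetoid (σ : Ty) : Setoid (PTm σ) where
  r s t := ∀ᶠ m in atTop, Prf T (hyps T φ e m) (eqT σ (s.down e m) (t.down e m))
  iseqv :=
    { refl := fun _ => Eventually.of_forall fun _ => .eqT_refl hR _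
      symm := fun h => h.mono fun _ h => .eqT_symm hR hT h
      trans := fun h h' => (h.and h').mono fun _ h => .eqT_trans hR hT h.1 h.2 }

/-- The quotient of the closed terms with parameters by provable equality. -/
def termModel : Model where
  M σ := Quotient (pSetoid φ e hT hR σ)
  app := Quotient.map₂ PTm.app fun _ _ h _ _ h' =>
    (Eventually.and h h').mono fun _ h => .eqT_congr hR hT h.1 h.2
  cst c := Quotient.mk _ (.cst c)
  lt := Quotient.lift₂
    (fun s t => ∀ᶠ m in atTop, Prf T (hyps T φ e m) (s.down e m ≺ t.down e m))
    (by
      have key : ∀ a b c d, (pSetoid φ e hT hR T0).r a b → (pSetoid φ e hT hR T0).r c d →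
          (∀ᶠ m in atTop, Prf T (hyps T φ e m) (a.down e m ≺ c.down e m)) →
          ∀ᶠ m in atTop, Prf T (hyps T φ e m) (b.down e m ≺ d.down e m) :=
        fun a b c d h h' h'' => (h.and (h'.and h'')).mono fun m h =>
          .impE (.impE (.impE (.ax (hR _ (RCA.lt_congr _ _ _ _))) h.1) h.2.1) h.2.2
      intro a c b d h h'
      exact propext ⟨key a b c d h h', key b a d c
        ((pSetoid φ e hT hR T0).symm h) ((pSetoid φ e hT hR T0).symm h')⟩)

/-- The assignment in the term model given by an assignment of parameters. -/
def termEnv {Γ : Ctx} (θ : PEnv Γ) : (termModel φ e hT hR).VEnv Γ :=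
  fun _ x => Quotient.mk _ (θ _ x)

def PTm.subst {Γ : Ctx} (θ : PEnv Γ) : {σ : Ty} → Tm Γ σ → PTm σ
  | _, .var x => θ _ x
  | _, .cst c => .cst c
  | _, .app s t => .app (subst θ s) (subst θ t)

theorem PTm.down_subst {Γ : Ctx} (θ : PEnv Γ) {σ : Ty} (t : Tm Γ σ) (m : ℕ) :
    (PTm.subst θ t).down e m = t.sub (θ.down e m) := by
  induction t with
  | var x => rfl
  | cst c => rfl
  | app s t hs ht => simp only [PTm.subst, PTm.down, Tm.sub, hs, ht]

theorem eval_termEnv {Γ : Ctx} (θ : PEnv Γ) {σ : Ty} (t : Tm Γ σ) :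
    Model.eval (termEnv φ e hT hR θ) t = Quotient.mk _ (PTm.subst θ t) := by
  induction t with
  | var x => rfl
  | cst c => rfl
  | app s t hs ht => simp only [Model.eval, hs, ht]; rfl

theorem termEnv_cons {Γ : Ctx} {τ : Ty} (t : PTm τ) (θ : PEnv Γ) :
    termEnv φ e hT hR (PEnv.cons t θ) =
      Model.VEnv.cons (𝔐 := termModel φ e hT hR) (Quotient.mk _ t) (termEnv φ e hT hR θ) := by
  funext σ x
  cases x <;> rfl

variable {φ e}
variable (hφ : ¬T.Proves φ) (he : ∀ t, ∃ᶠ m in atTop, e m = t)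
include hφ

theorem not_tr_neg {Γ : Ctx} {A : Fm Γ} {θ : PEnv Γ} (h : Tr T φ e A θ) : ¬Tr T φ e (∼A) θ :=
  fun h' => by
    obtain ⟨m, h₁, h₂⟩ := (h.and h').exists
    exact con_hyps hφ m (.impE h₂ h₁)

include he

/-- The truth lemma. Disjunction and implication use completeness (`tr_em`), the existential
quantifier uses Henkin witnesses, and a failing universal statement is turned into an existential
one. -/
theorem tr_iff_sat {Γ : Ctx} (A : Fm Γ) (θ : PEnv Γ) :
    Tr T φ e A θ ↔ Model.Sat (termEnv φ e hT hR θ) A := by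
  induction A with
  | eq s t =>
    have : Model.Sat (termEnv φ e hT hR θ) (s ≐ t) ↔
        (pSetoid φ e hT hR T0).r (PTm.subst θ s) (PTm.subst θ t) := by
      simp only [Model.Sat, eval_termEnv]
      exact Quotient.eq
    rw [this]
    simp only [Tr, Fm.sub, ← PTm.down_subst]
    rfl
  | lt s t =>
    simp only [Model.Sat, eval_termEnv, Tr, Fm.sub, ← PTm.down_subst]
    rfl
  | bot =>
    refine ⟨fun h => ?_, fun h => h.elim⟩
    obtain ⟨m, hm⟩ := h.exists
    exact con_hyps hφ m hm
  | and A B hA hB =>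
    rw [Model.Sat, ← hA, ← hB]
    exact ⟨fun h => ⟨h.mono fun _ h => .andL h, h.mono fun _ h => .andR h⟩,
      fun h => (h.1.and h.2).mono fun _ h => .andI h.1 h.2⟩
  | or A B hA hB =>
    rw [Model.Sat, ← hA, ← hB]
    refine ⟨fun h => ?_, fun h => h.elim (fun h => h.mono fun _ h => .orL h)
      fun h => h.mono fun _ h => .orR h⟩
    refine (tr_em hT he A θ).imp_right fun hn => (h.and hn).mono fun m h => ?_
    exact .orE h.1 (.raa (.impE (h.2.mono (by simp)) (.hyp (by simp)))) (.hyp (by simp))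
  | imp A B hA hB =>
    rw [Model.Sat, ← hA, ← hB]
    refine ⟨fun h h' => (h.and h').mono fun _ h => .impE h.1 h.2, fun h => ?_⟩
    rcases tr_em (φ := φ) (e := e) hT he A θ with hn | hn
    · exact (h hn).mono fun m h => .impI (h.mono (by simp))
    · exact hn.mono fun m h => .impI (.raa (.impE (h.mono (by simp)) (.hyp (by simp))))
  | all σ A hA =>
    rw [Model.Sat]
    constructor
    · intro h a
      induction a using Quotient.inductionOn with | _ a
      rw [← termEnv_cons, ← hA]
      refine h.mono fun m h => ?_
      rw [PEnv.down_cons, ← Fm.sub_lift_inst]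
      exact .allE _ h
    · intro h
      refine (tr_em hT he (.all σ A) θ).resolve_right fun hn => ?_
      have : Tr T φ e (.ex σ (∼A)) θ := by
        refine hn.mono fun m h => .raa (.impE (h.mono (by simp)) (.allI (.raa ?_)))
        have h₁ : Prf T ((∼((A.sub ((θ.down e m).lift σ))) : Fm _) :: (hyps T φ e m).map (Fm.wk σ))
            ((Fm.ex σ (∼(A.sub ((θ.down e m).lift σ)))).wk σ) := .ex_self (.hyp (by simp))
        refine .impE (.hyp (A := (∼(Fm.ex σ (∼(A.sub ((θ.down e m).lift σ))))).wk σ)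
          (by simp [Fm.sub])) (h₁.mono (by simp))
      obtain ⟨t, ht⟩ := tr_henkin hT hφ he this
      have h₁ := h (Quotient.mk _ t)
      rw [← termEnv_cons, ← hA] at h₁
      exact not_tr_neg hφ h₁ ht
  | ex σ A hA =>
    rw [Model.Sat]
    constructor
    · intro h
      obtain ⟨t, ht⟩ := tr_henkin hT hφ he h
      rw [hA, termEnv_cons] at ht
      exact ⟨_, ht⟩
    · rintro ⟨a, h⟩
      induction a using Quotient.inductionOn with | _ a
      rw [← termEnv_cons, ← hA] at h
      refine h.mono fun m h => ?_
      rw [PEnv.down_cons, ← Fm.sub_lift_inst] at h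
      exact .exI _ h

/-- The elements of the term model are the classes of the terms `u`, so by the truth lemma the
hypothesis makes the universal formula `eqT (σ ⇒ τ)` true, that is, eventually derivable. -/
theorem tr_eqT_arr {σ τ : Ty} (s t : PTm (σ ⇒ τ))
    (h : ∀ u : PTm σ, (pSetoid φ e hT hR τ).r (.app s u) (.app t u)) :
    (pSetoid φ e hT hR (σ ⇒ τ)).r s t := by
  let θ : PEnv [σ ⇒ τ, σ ⇒ τ] := PEnv.cons s (PEnv.cons t fun _ x => nomatch x)
  have key : Tr T φ e (eqT (σ ⇒ τ) v0 v1) θ := by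
    rw [eqT, tr_iff_sat hT hR hφ he, Model.Sat]
    intro a
    induction a using Quotient.inductionOn with | _ a
    rw [← termEnv_cons, ← tr_iff_sat hT hR hφ he]
    refine (h a).mono fun m h => ?_
    rw [eqT_sub]
    exact h
  refine Eventually.mono key fun m h => ?_
  rw [eqT_sub] at h
  exact h

/-- The term model, for a consistent theory. -/
def termExtModel : ExtModel T where
  toModel := termModel φ e hT hR
  ext := by
    intro σ τ f g h
    induction f using Quotient.inductionOn with | _ s
    induction g using Quotient.inductionOn with | _ t
    exact Quotient.sound (tr_eqT_arr hT hR hφ he s t fun u => Quotient.exact (h (Quotient.mk _ u)))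
  sat := by
    intro Γ A h ρ
    have : ρ = termEnv φ e hT hR fun σ x => (ρ σ x).out := by
      funext σ x
      exact (Quotient.out_eq _).symm
    rw [this, ← tr_iff_sat hT hR hφ he]
    exact Eventually.of_forall fun m => .ax (hT _ h)

end

/-- Completeness: what holds in all extensional models is provable. -/
theorem proves_of_forall_sat {T : Theory}
    (hT : ∀ {Γ Δ : Ctx} {A : Fm Γ} (θ : Sub Γ Δ), A ∈ T Γ → A.sub θ ∈ T Δ)
    (hR : ∀ Γ, RCA Γ ⊆ T Γ) {φ : Sentence}
    (h : ∀ 𝔐 : ExtModel T, Model.Sat (Model.VEnv.nil (𝔐 := 𝔐.toModel)) φ) : T.Proves φ := by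
  by_contra hφ
  obtain ⟨e, he⟩ := exists_task_enum
  have h₁ := h (termExtModel hT hR hφ he)
  let θ : PEnv [] := fun _ x => nomatch x
  have h₂ : Model.VEnv.nil = termEnv φ e hT hR θ := by
    funext σ x
    cases x
  have h₃ : Model.Sat (termEnv φ e hT hR θ) φ := h₂ ▸ h₁
  rw [← tr_iff_sat hT hR hφ he] at h₃
  -- The negation of `φ` is the hypothesis of stage 0, so it is true in the term model.
  refine not_tr_neg hφ h₃ (tr_of_stable hT (m := 0) (fun k _ => ?_) (.hyp ?_))
  · funext σ x
    cases x
  · have : (∼φ).sub (PEnv.down e 0 θ) = ∼φ := by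
      conv_rhs => rw [← Fm.sub_var (∼φ)]
      congr 1
      funext σ x
      cases x
    rw [this]
    exact List.mem_cons_self

/-! ### Extensional models of the theory with `QF-AC^{2,0}`. -/

abbrev HModel : Type 1 := ExtModel RCAQFAC20

variable {𝔐 : HModel}

/-- Application in a model. -/
def ap {σ τ : Ty} (f : 𝔐.M (σ ⇒ τ)) (x : 𝔐.M σ) : 𝔐.M τ := 𝔐.app f x

infixl:85 " ⬦ " => ap

open Model

theorem ap_ext {σ τ : Ty} {f g : 𝔐.M (σ ⇒ τ)} (h : ∀ x, f ⬦ x = g ⬦ x) : f = g := 𝔐.ext h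

theorem eval_ren {𝔐 : Model} {Γ Δ : Ctx} {σ : Ty} (t : Tm Γ σ) (r : Ren Γ Δ) (ρ : 𝔐.VEnv Δ) :
    eval ρ (t.ren r) = eval (fun _ x => ρ _ (r _ x)) t := by
  induction t with
  | var x => rfl
  | cst c => rfl
  | app s t hs ht => simp only [Tm.ren, eval, hs, ht]

theorem eval_wk {𝔐 : Model} {Γ : Ctx} {σ τ : Ty} (t : Tm Γ σ) (a : 𝔐.M τ) (ρ : 𝔐.VEnv Γ) :
    eval (VEnv.cons a ρ) (t.wk τ) = eval ρ t := eval_ren t _ _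

theorem sat_eqT {τ : Ty} {Γ : Ctx} (s t : Tm Γ τ) (ρ : 𝔐.VEnv Γ) :
    Sat ρ (eqT τ s t) ↔ eval ρ s = eval ρ t := by
  induction τ generalizing Γ with
  | o => rfl
  | arr σ τ _ ih =>
    simp only [eqT, Sat, ih]
    simp only [eval, eval_wk]
    exact ⟨fun h => 𝔐.ext h, fun h a => by rw [h]⟩

theorem sat_rca {Γ : Ctx} {A : Fm Γ} (h : RCA Γ A) (ρ : 𝔐.VEnv Γ) : Sat ρ A :=
  𝔐.sat (Or.inl h) ρ

abbrev env1 {σ : Ty} (a : 𝔐.M σ) : 𝔐.VEnv [σ] := VEnv.cons a VEnv.nil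
abbrev env2 {σ τ : Ty} (a : 𝔐.M σ) (b : 𝔐.M τ) : 𝔐.VEnv [σ, τ] := VEnv.cons a (env1 b)
abbrev env3 {ρ σ τ : Ty} (a : 𝔐.M ρ) (b : 𝔐.M σ) (c : 𝔐.M τ) : 𝔐.VEnv [ρ, σ, τ] :=
  VEnv.cons a (env2 b c)

/-! The natural numbers of a model. -/

instance : Zero (𝔐.M T0) := ⟨𝔐.cst .zero⟩
instance : One (𝔐.M T0) := ⟨𝔐.cst .one⟩
instance : Add (𝔐.M T0) := ⟨fun a b => ap (ap (𝔐.cst .add) a) b⟩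
instance : Mul (𝔐.M T0) := ⟨fun a b => ap (ap (𝔐.cst .mul) a) b⟩

theorem add_comm' (a b : 𝔐.M T0) : a + b = b + a := sat_rca (RCA.add_comm v0 v1) (env2 a b)
theorem add_zero' (a : 𝔐.M T0) : a + 0 = a := sat_rca (RCA.add_zero v0) (env1 a)
theorem mul_comm' (a b : 𝔐.M T0) : a * b = b * a := sat_rca (RCA.mul_comm v0 v1) (env2 a b)
theorem mul_one' (a : 𝔐.M T0) : a * 1 = a := sat_rca (RCA.mul_one v0) (env1 a)
theorem mul_zero' (a : 𝔐.M T0) : a * 0 = 0 := sat_rca (RCA.mul_zero v0) (env1 a)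
theorem mul_add' (a b c : 𝔐.M T0) : a * (b + c) = a * b + a * c :=
  sat_rca (RCA.mul_add v0 v1 v2) (env3 a b c)

instance : CommSemiring (𝔐.M T0) where
  add_assoc a b c := sat_rca (RCA.add_assoc v0 v1 v2) (env3 a b c)
  zero_add a := by rw [add_comm', add_zero']
  add_zero := add_zero'
  add_comm := add_comm'
  nsmul := nsmulRec
  mul_assoc a b c := sat_rca (RCA.mul_assoc v0 v1 v2) (env3 a b c)
  mul_comm := mul_comm'
  one_mul a := by rw [mul_comm', mul_one']
  mul_one := mul_one'
  mul_zero := mul_zero'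
  zero_mul a := by rw [mul_comm', mul_zero']
  left_distrib := mul_add'
  right_distrib a b c := by rw [mul_comm', mul_add', mul_comm' c, mul_comm' c]

theorem lt_irrefl' (a : 𝔐.M T0) : ¬𝔐.lt a a := sat_rca (RCA.lt_irrefl v0) (env1 a)
theorem lt_trans' {a b c : 𝔐.M T0} : 𝔐.lt a b → 𝔐.lt b c → 𝔐.lt a c :=
  sat_rca (RCA.lt_trans v0 v1 v2) (env3 a b c)

noncomputable instance : LinearOrder (𝔐.M T0) where
  lt a b := 𝔐.lt a b
  le a b := 𝔐.lt a b ∨ a = b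
  le_refl a := Or.inr rfl
  le_trans a b c h h' := by
    rcases h with h | rfl
    · rcases h' with h' | rfl
      · exact Or.inl (lt_trans' h h')
      · exact Or.inl h
    · exact h'
  lt_iff_le_not_ge a b := by
    constructor
    · intro h
      refine ⟨Or.inl h, ?_⟩
      rintro (h' | rfl)
      · exact lt_irrefl' _ (lt_trans' h h')
      · exact lt_irrefl' _ h
    · rintro ⟨h | rfl, h'⟩
      · exact h
      · exact (h' (Or.inr rfl)).elim
  le_antisymm a b h h' := by
    rcases h with h | rfl
    · rcases h' with h' | rfl
      · exact (lt_irrefl' _ (lt_trans' h h')).elim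
      · rfl
    · rfl
  le_total a b := by
    rcases (sat_rca (RCA.lt_total v0 v1) (env2 a b) :
      𝔐.lt a b ∨ a = b ∨ 𝔐.lt b a) with h | h | h
    · exact Or.inl (Or.inl h)
    · exact Or.inl (Or.inr h)
    · exact Or.inr (Or.inl h)
  toDecidableLE := Classical.decRel _

theorem add_lt_add' {a b : 𝔐.M T0} (h : a < b) (c : 𝔐.M T0) : a + c < b + c :=
  sat_rca (RCA.add_lt_add v0 v1 v2) (env3 a b c) h
theorem mul_lt_mul' {a b c : 𝔐.M T0} (h : a < b) (hc : 0 < c) : a * c < b * c :=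
  sat_rca (RCA.mul_lt_mul v0 v1 v2) (env3 a b c) h hc
theorem nat_zero_lt_one : (0 : 𝔐.M T0) < 1 := sat_rca RCA.zero_lt_one VEnv.nil
theorem nat_zero_le (a : 𝔐.M T0) : 0 ≤ a := sat_rca (RCA.zero_le v0) (env1 a)
theorem nat_succ_le {a b : 𝔐.M T0} (h : a < b) : a + 1 ≤ b :=
  sat_rca (RCA.discrete v0 v1) (env2 a b) h

instance : IsStrictOrderedRing (𝔐.M T0) where
  add_le_add_left a b h c := by
    rcases h.lt_or_eq with h | rfl
    · exact (add_lt_add' h c).le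
    · exact le_rfl
  le_of_add_le_add_left a b c h := by
    by_contra! h'
    have := add_lt_add' h' a
    rw [add_comm, add_comm b] at this
    exact absurd h this.not_ge
  zero_le_one := nat_zero_lt_one.le
  exists_pair_ne := ⟨0, 1, nat_zero_lt_one.ne⟩
  mul_lt_mul_of_pos_left a ha b c h := by
    have := mul_lt_mul' h ha
    rwa [mul_comm, mul_comm c] at this
  mul_lt_mul_of_pos_right a ha b c h := mul_lt_mul' h ha

theorem nat_lt_succ_iff {a b : 𝔐.M T0} : a < b + 1 ↔ a ≤ b := by
  refine ⟨fun h => ?_, fun h => h.trans_lt (lt_add_one b)⟩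
  by_contra! h'
  exact absurd (nat_succ_le h') h.not_ge

theorem nat_pos_iff {a : 𝔐.M T0} : 0 < a ↔ a ≠ 0 :=
  ⟨fun h => h.ne', fun h => (nat_zero_le a).lt_of_ne' h⟩

theorem nat_not_lt_zero (a : 𝔐.M T0) : ¬a < 0 := (nat_zero_le a).not_gt

/-! Combinatory completeness. -/

variable (𝔐) in
def kE (σ τ : Ty) : 𝔐.M (σ ⇒ τ ⇒ σ) := 𝔐.cst (.K σ τ)
variable (𝔐) in
def sE (ρ σ τ : Ty) : 𝔐.M ((ρ ⇒ σ ⇒ τ) ⇒ (ρ ⇒ σ) ⇒ ρ ⇒ τ) := 𝔐.cst (.S ρ σ τ)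
variable (𝔐) in
def rE : 𝔐.M (T1 ⇒ T0 ⇒ T0 ⇒ T0) := 𝔐.cst (.R T0)

theorem kE_ap {σ τ : Ty} (x : 𝔐.M σ) (y : 𝔐.M τ) : kE 𝔐 σ τ ⬦ x ⬦ y = x :=
  (sat_eqT _ _ _).1 (sat_rca (RCA.k_ax v0 v1) (env2 x y))

theorem sE_ap {ρ σ τ : Ty} (x : 𝔐.M (ρ ⇒ σ ⇒ τ)) (y : 𝔐.M (ρ ⇒ σ)) (w : 𝔐.M ρ) :
    sE 𝔐 ρ σ τ ⬦ x ⬦ y ⬦ w = x ⬦ w ⬦ (y ⬦ w) :=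
  (sat_eqT _ _ _).1 (sat_rca (RCA.s_ax v0 v1 v2) (env3 x y w))

theorem rE_zero (f : 𝔐.M T1) (m : 𝔐.M T0) : rE 𝔐 ⬦ f ⬦ m ⬦ (0 : 𝔐.M T0) = m :=
  sat_rca (RCA.rec_zero v0 v1) (env2 f m)

theorem rE_succ (f : 𝔐.M T1) (m n : 𝔐.M T0) : rE 𝔐 ⬦ f ⬦ m ⬦ (n + 1) = f ⬦ (rE 𝔐 ⬦ f ⬦ m ⬦ n) :=
  sat_rca (RCA.rec_succ v0 v1 v2) (env3 f m n)

variable (𝔐) in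
/-- Tuples of elements of a model. -/
def DEnv : Ctx → Type
  | [] => Unit
  | σ :: Γ => 𝔐.M σ × DEnv Γ

/-- Bracket abstraction: the variables are removed one at a time by currying. In the empty context
nothing is required, since a value is already an element of the model. -/
def IsDef {τ : Ty} : (Γ : Ctx) → (DEnv 𝔐 Γ → 𝔐.M τ) → Prop
  | [], _ => True
  | σ :: Γ, F => ∃ c : DEnv 𝔐 Γ → 𝔐.M (σ ⇒ τ), IsDef Γ c ∧ ∀ x e, c e ⬦ x = F (x, e)

/-- The function `F` is represented by an element of the model. -/
class Def (Γ : Ctx) {τ : Ty} (F : DEnv 𝔐 Γ → 𝔐.M τ) : Prop where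
  out : IsDef Γ F

theorem IsDef.const (Γ : Ctx) {τ : Ty} (a : 𝔐.M τ) : IsDef Γ (fun _ : DEnv 𝔐 Γ => a) := by
  induction Γ generalizing τ with
  | nil => trivial
  | cons σ Γ ih => exact ⟨fun _ => kE 𝔐 τ σ ⬦ a, ih _, fun x _ => kE_ap a x⟩

theorem IsDef.ap {Γ : Ctx} {σ τ : Ty} {F : DEnv 𝔐 Γ → 𝔐.M (σ ⇒ τ)} {G : DEnv 𝔐 Γ → 𝔐.M σ}
    (hF : IsDef Γ F) (hG : IsDef Γ G) : IsDef Γ (fun e => F e ⬦ G e) := by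
  induction Γ generalizing σ τ with
  | nil => trivial
  | cons ρ Γ ih =>
    obtain ⟨c, hc, hcF⟩ := hF
    obtain ⟨d, hd, hdG⟩ := hG
    refine ⟨fun e => sE 𝔐 ρ σ τ ⬦ c e ⬦ d e, ih (ih (IsDef.const _ _) hc) hd, fun x e => ?_⟩
    simp only [sE_ap, hcF, hdG]

theorem IsDef.snd {Γ : Ctx} {σ τ : Ty} {F : DEnv 𝔐 Γ → 𝔐.M τ} (hF : IsDef Γ F) :
    IsDef (σ :: Γ) (fun e : DEnv 𝔐 (σ :: Γ) => F e.2) :=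
  ⟨fun e => kE 𝔐 τ σ ⬦ F e, (IsDef.const _ _).ap hF, fun x e => kE_ap (F e) x⟩

theorem IsDef.fst {Γ : Ctx} {σ : Ty} : IsDef (σ :: Γ) (fun e : DEnv 𝔐 (σ :: Γ) => e.1) :=
  -- The identity as `S K K`.
  ⟨fun _ => sE 𝔐 σ (T0 ⇒ σ) σ ⬦ kE 𝔐 σ (T0 ⇒ σ) ⬦ kE 𝔐 σ T0, IsDef.const _ _, fun x e => by
    rw [sE_ap, kE_ap]⟩

instance (priority := high) Def.const {Γ : Ctx} {τ : Ty} (a : 𝔐.M τ) :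
    Def Γ (fun _ : DEnv 𝔐 Γ => a) := ⟨IsDef.const Γ a⟩

instance Def.var0 {Γ : Ctx} {σ : Ty} : Def (σ :: Γ) (fun e : DEnv 𝔐 (σ :: Γ) => e.1) :=
  ⟨IsDef.fst⟩
instance Def.var1 {Γ : Ctx} {σ τ : Ty} :
    Def (τ :: σ :: Γ) (fun e : DEnv 𝔐 (τ :: σ :: Γ) => e.2.1) := ⟨IsDef.fst.snd⟩
instance Def.var2 {Γ : Ctx} {σ τ υ : Ty} :
    Def (υ :: τ :: σ :: Γ) (fun e : DEnv 𝔐 (υ :: τ :: σ :: Γ) => e.2.2.1) := ⟨IsDef.fst.snd.snd⟩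
instance Def.var3 {Γ : Ctx} {σ τ υ ω : Ty} :
    Def (ω :: υ :: τ :: σ :: Γ) (fun e : DEnv 𝔐 (ω :: υ :: τ :: σ :: Γ) => e.2.2.2.1) :=
  ⟨IsDef.fst.snd.snd.snd⟩

section
variable {Γ : Ctx} {σ τ : Ty}

instance Def.ap (F : DEnv 𝔐 Γ → 𝔐.M (σ ⇒ τ)) (G : DEnv 𝔐 Γ → 𝔐.M σ)
    [hF : Def Γ F] [hG : Def Γ G] : Def Γ (fun e => F e ⬦ G e) := ⟨hF.out.ap hG.out⟩

instance Def.add (F G : DEnv 𝔐 Γ → 𝔐.M T0) [hF : Def Γ F] [hG : Def Γ G] :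
    Def Γ (fun e => F e + G e) := ⟨((IsDef.const _ _).ap hF.out).ap hG.out⟩

instance Def.mul (F G : DEnv 𝔐 Γ → 𝔐.M T0) [hF : Def Γ F] [hG : Def Γ G] :
    Def Γ (fun e => F e * G e) := ⟨((IsDef.const _ _).ap hF.out).ap hG.out⟩

theorem Def.exists_rep {F : DEnv 𝔐 (σ :: Γ) → 𝔐.M τ} (h : Def (σ :: Γ) F) :
    ∃ c : DEnv 𝔐 Γ → 𝔐.M (σ ⇒ τ), Def Γ c ∧ ∀ x e, c e ⬦ x = F (x, e) :=
  let ⟨c, hc, h⟩ := h.out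
  ⟨c, ⟨hc⟩, h⟩

instance : Nonempty (𝔐.M σ) := by
  induction σ with
  | o => exact ⟨0⟩
  | arr σ τ _ ih => exact ih.map fun a => kE 𝔐 τ σ ⬦ a

/-- The element of the model that represents `f`. -/
noncomputable def lam (f : 𝔐.M σ → 𝔐.M τ) : 𝔐.M (σ ⇒ τ) :=
  Classical.epsilon fun c => ∀ x, c ⬦ x = f x

theorem lam_eq {f : 𝔐.M σ → 𝔐.M τ} {c : 𝔐.M (σ ⇒ τ)} (h : ∀ x, c ⬦ x = f x) : lam f = c :=
  ap_ext fun x => (Classical.epsilon_spec (p := fun c => ∀ x, c ⬦ x = f x) ⟨c, h⟩ x).trans (h x).symm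

@[simp]
theorem lam_ap (f : 𝔐.M σ → 𝔐.M τ) [h : Def [σ] (fun e : DEnv 𝔐 [σ] => f e.1)] (x : 𝔐.M σ) :
    lam f ⬦ x = f x := by
  obtain ⟨c, _, hc⟩ := h.exists_rep
  rw [lam_eq fun x => hc x ()]
  exact hc x ()

/-- By extensionality representatives are unique, so the arbitrarily chosen `lam (F e)` coincides
with the one that depends definably on `e`. -/
instance Def.lam (F : DEnv 𝔐 Γ → 𝔐.M σ → 𝔐.M τ)
    [h : Def (σ :: Γ) (fun e : DEnv 𝔐 (σ :: Γ) => F e.2 e.1)] : Def Γ (fun e => lam (F e)) := by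
  obtain ⟨c, hc, h⟩ := h.exists_rep
  rwa [show (fun e => HOA.lam (F e)) = c from funext fun e => lam_eq fun x => h x e]

end

/-! Decidable predicates. -/

/-- The predicate `P` has a characteristic function in the model. -/
class Dec (Γ : Ctx) (P : DEnv 𝔐 Γ → Prop) : Prop where
  out : ∃ c : DEnv 𝔐 Γ → 𝔐.M T0, Def Γ c ∧ ∀ e, P e ↔ c e = 0

theorem Dec.of_def {Γ : Ctx} {P : DEnv 𝔐 Γ → Prop} (c : DEnv 𝔐 Γ → 𝔐.M T0) [h : Def Γ c]
    (hc : ∀ e, P e ↔ c e = 0) : Dec Γ P := ⟨c, h, hc⟩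

variable (𝔐) in
-- `QF-AC^{1,0}` applied to a definition by cases turns an atomic formula into a functional. The two
-- numbers to be compared are packed into one argument of type 1, as its values at `0` and `1`.
theorem exists_eq_char : ∃ Y : 𝔐.M T2, ∀ x : 𝔐.M T1,
    x ⬦ (0 : 𝔐.M T0) = x ⬦ (1 : 𝔐.M T0) ↔ Y ⬦ x = 0 := by
  have key := (sat_rca (RCA.qfac _ (QFAC.intro
    (((v1 ⬝ zero ≐ v1 ⬝ one ⇾ v0 ≐ zero) ⩑ (∼(v1 ⬝ zero ≐ v1 ⬝ one) ⇾ v0 ≐ one)) : Fm [T0, T1])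
      (by simp [Fm.QF]))) VEnv.nil :
    (∀ x : 𝔐.M T1, ∃ y : 𝔐.M T0, (x ⬦ (0 : 𝔐.M T0) = x ⬦ (1 : 𝔐.M T0) → y = 0) ∧
      (¬x ⬦ (0 : 𝔐.M T0) = x ⬦ (1 : 𝔐.M T0) → y = 1)) →
    ∃ Y : 𝔐.M T2, ∀ x : 𝔐.M T1, (x ⬦ (0 : 𝔐.M T0) = x ⬦ (1 : 𝔐.M T0) → Y ⬦ x = 0) ∧
      (¬x ⬦ (0 : 𝔐.M T0) = x ⬦ (1 : 𝔐.M T0) → Y ⬦ x = 1))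
  obtain ⟨Y, hY⟩ := key (fun x => by
    by_cases h : x ⬦ (0 : 𝔐.M T0) = x ⬦ (1 : 𝔐.M T0)
    · exact ⟨0, fun _ => rfl, fun h' => (h' h).elim⟩
    · exact ⟨1, fun h' => (h h').elim, fun _ => rfl⟩)
  refine ⟨Y, fun x => ⟨(hY x).1, fun h => ?_⟩⟩
  by_contra h'
  exact one_ne_zero (((hY x).2 h').symm.trans h)

variable (𝔐) in
theorem exists_lt_char : ∃ Y : 𝔐.M T2, ∀ x : 𝔐.M T1,
    x ⬦ (0 : 𝔐.M T0) < x ⬦ (1 : 𝔐.M T0) ↔ Y ⬦ x = 0 := by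
  have key := (sat_rca (RCA.qfac _ (QFAC.intro
    (((v1 ⬝ zero ≺ v1 ⬝ one ⇾ v0 ≐ zero) ⩑ (∼(v1 ⬝ zero ≺ v1 ⬝ one) ⇾ v0 ≐ one)) : Fm [T0, T1])
      (by simp [Fm.QF]))) VEnv.nil :
    (∀ x : 𝔐.M T1, ∃ y : 𝔐.M T0, (x ⬦ (0 : 𝔐.M T0) < x ⬦ (1 : 𝔐.M T0) → y = 0) ∧
      (¬x ⬦ (0 : 𝔐.M T0) < x ⬦ (1 : 𝔐.M T0) → y = 1)) →
    ∃ Y : 𝔐.M T2, ∀ x : 𝔐.M T1, (x ⬦ (0 : 𝔐.M T0) < x ⬦ (1 : 𝔐.M T0) → Y ⬦ x = 0) ∧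
      (¬x ⬦ (0 : 𝔐.M T0) < x ⬦ (1 : 𝔐.M T0) → Y ⬦ x = 1))
  obtain ⟨Y, hY⟩ := key (fun x => by
    by_cases h : x ⬦ (0 : 𝔐.M T0) < x ⬦ (1 : 𝔐.M T0)
    · exact ⟨0, fun _ => rfl, fun h' => (h' h).elim⟩
    · exact ⟨1, fun h' => (h h').elim, fun _ => rfl⟩)
  refine ⟨Y, fun x => ⟨(hY x).1, fun h => ?_⟩⟩
  by_contra h'
  exact one_ne_zero (((hY x).2 h').symm.trans h)

/-- The function with value `a` at `0` and `b` at `1`. -/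
def two (a b : 𝔐.M T0) : 𝔐.M T1 := rE 𝔐 ⬦ (kE 𝔐 T0 T0 ⬦ b) ⬦ a

theorem two_zero (a b : 𝔐.M T0) : two a b ⬦ (0 : 𝔐.M T0) = a := rE_zero _ _
theorem two_one (a b : 𝔐.M T0) : two a b ⬦ (1 : 𝔐.M T0) = b := by
  rw [← zero_add (1 : 𝔐.M T0)]
  exact (rE_succ _ _ _).trans (kE_ap _ _)

section
variable {Γ : Ctx}

instance Def.two (F G : DEnv 𝔐 Γ → 𝔐.M T0) [Def Γ F] [Def Γ G] :
    Def Γ (fun e => two (F e) (G e)) := by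
  unfold HOA.two
  infer_instance

instance Dec.eq (F G : DEnv 𝔐 Γ → 𝔐.M T0) [Def Γ F] [Def Γ G] : Dec Γ (fun e => F e = G e) := by
  obtain ⟨Y, hY⟩ := exists_eq_char 𝔐
  refine .of_def (fun e => Y ⬦ two (F e) (G e)) fun e => ?_
  rw [← hY, two_zero, two_one]

instance Dec.lt (F G : DEnv 𝔐 Γ → 𝔐.M T0) [Def Γ F] [Def Γ G] : Dec Γ (fun e => F e < G e) := by
  obtain ⟨Y, hY⟩ := exists_lt_char 𝔐
  refine .of_def (fun e => Y ⬦ two (F e) (G e)) fun e => ?_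
  rw [← hY, two_zero, two_one]

instance (priority := high) Dec.const (p : Prop) : Dec Γ (fun _ : DEnv 𝔐 Γ => p) := by
  by_cases h : p
  · exact .of_def (fun _ => 0) fun _ => by simp [h]
  · exact .of_def (fun _ => 1) fun _ => by simp [h]

variable (P Q : DEnv 𝔐 Γ → Prop) [hP : Dec Γ P] [hQ : Dec Γ Q]

instance Dec.not : Dec Γ (fun e => ¬P e) := by
  obtain ⟨c, hc, h⟩ := hP
  obtain ⟨d, hd, h'⟩ : Dec Γ (fun e => 0 < c e) := inferInstance
  exact ⟨d, hd, fun e => by rw [← h', h, nat_pos_iff]⟩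

instance Dec.and : Dec Γ (fun e => P e ∧ Q e) := by
  obtain ⟨c, hc, h⟩ := hP
  obtain ⟨d, hd, h'⟩ := hQ
  refine .of_def (fun e => c e + d e) fun e => ?_
  rw [h, h', add_eq_zero_iff_of_nonneg (nat_zero_le _) (nat_zero_le _)]

instance Dec.or : Dec Γ (fun e => P e ∨ Q e) := by
  have : Dec Γ (fun e => ¬(¬P e ∧ ¬Q e)) := inferInstance
  simpa only [not_and_or, not_not] using this

instance Dec.imp : Dec Γ (fun e => P e → Q e) := by
  have : Dec Γ (fun e => ¬P e ∨ Q e) := inferInstance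
  simpa only [← imp_iff_not_or] using this

instance Dec.ne (F G : DEnv 𝔐 Γ → 𝔐.M T0) [Def Γ F] [Def Γ G] : Dec Γ (fun e => F e ≠ G e) :=
  inferInstanceAs (Dec Γ (fun e => ¬F e = G e))

end

/-! Induction and choice. -/

/-- Once `P` is the equation `f ⬦ x = 0` with `f` as a parameter, it falls under the quantifier-free
schemata. -/
theorem exists_rep_one {σ : Ty} (P : 𝔐.M σ → Prop) [h : Dec [σ] (fun e : DEnv 𝔐 [σ] => P e.1)] :
    ∃ f : 𝔐.M (σ ⇒ T0), ∀ x, P x ↔ f ⬦ x = 0 := by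
  obtain ⟨c, hc, h⟩ := h
  obtain ⟨f, -, hf⟩ := hc.exists_rep
  exact ⟨f (), fun x => (h (x, ())).trans (Eq.congr (hf x ()).symm rfl)⟩

theorem exists_rep_two {σ τ : Ty} (P : 𝔐.M σ → 𝔐.M τ → Prop)
    [h : Dec [τ, σ] (fun e : DEnv 𝔐 [τ, σ] => P e.2.1 e.1)] :
    ∃ f : 𝔐.M (σ ⇒ τ ⇒ T0), ∀ x y, P x y ↔ f ⬦ x ⬦ y = 0 := by
  obtain ⟨c, hc, h⟩ := h
  obtain ⟨d, hd, hdc⟩ := hc.exists_rep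
  obtain ⟨f, -, hf⟩ := hd.exists_rep
  exact ⟨f (), fun x y => (h (y, x, ())).trans (Eq.congr
    ((congrArg (· ⬦ y) (hf x ())).trans (hdc y (x, ()))).symm rfl)⟩

theorem nat_ind {P : 𝔐.M T0 → Prop} [h : Dec [T0] (fun e : DEnv 𝔐 [T0] => P e.1)] (h0 : P 0)
    (hs : ∀ n, P n → P (n + 1)) (n : 𝔐.M T0) : P n := by
  obtain ⟨f, key⟩ := exists_rep_one P
  rw [key] at h0 ⊢
  simp only [key] at hs
  exact (sat_rca (RCA.ind (v1 ⬝ v0 ≐ zero : Fm [T0, T1]) trivial) (env1 f) :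
    (f ⬦ 0 = 0 ∧ ∀ n, f ⬦ n = 0 → f ⬦ (n + 1) = 0) → ∀ n, f ⬦ n = 0) ⟨h0, hs⟩ n

theorem choice_of_qfac {σ : Ty} (hσ : ∀ Γ, QFAC σ T0 Γ ⊆ RCAQFAC20 Γ) {P : 𝔐.M σ → 𝔐.M T0 → Prop}
    [h : Dec [T0, σ] (fun e : DEnv 𝔐 [T0, σ] => P e.2.1 e.1)] (hP : ∀ x, ∃ y, P x y) :
    ∃ Y : 𝔐.M (σ ⇒ T0), ∀ x, P x (Y ⬦ x) := by
  obtain ⟨f, key⟩ := exists_rep_two P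
  simp only [key] at hP ⊢
  exact (𝔐.sat (hσ _ (QFAC.intro (v2 ⬝ v1 ⬝ v0 ≐ zero : Fm [T0, σ, σ ⇒ T0 ⇒ T0]) trivial))
    (env1 f) : (∀ x, ∃ y, f ⬦ x ⬦ y = 0) → ∃ Y : 𝔐.M (σ ⇒ T0), ∀ x,
      f ⬦ x ⬦ (Y ⬦ x) = 0) hP

theorem choice_one {P : 𝔐.M T1 → 𝔐.M T0 → Prop}
    [h : Dec [T0, T1] (fun e : DEnv 𝔐 [T0, T1] => P e.2.1 e.1)] (hP : ∀ x, ∃ y, P x y) :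
    ∃ Y : 𝔐.M T2, ∀ x, P x (Y ⬦ x) :=
  choice_of_qfac (fun _ _ h => Or.inl (RCA.qfac _ h)) hP

theorem choice_two {P : 𝔐.M T2 → 𝔐.M T0 → Prop}
    [h : Dec [T0, T2] (fun e : DEnv 𝔐 [T0, T2] => P e.2.1 e.1)] (hP : ∀ x, ∃ y, P x y) :
    ∃ Y : 𝔐.M T3, ∀ x, P x (Y ⬦ x) :=
  choice_of_qfac (fun _ _ h => Or.inr h) hP

/-- A number is represented by the constant function with that value, which reduces the claim to
choice over type 1. -/
theorem choice_zero {P : 𝔐.M T0 → 𝔐.M T0 → Prop}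
    [h : Dec [T0, T0] (fun e : DEnv 𝔐 [T0, T0] => P e.2.1 e.1)] (hP : ∀ x, ∃ y, P x y) :
    ∃ Y : 𝔐.M T1, ∀ x, P x (Y ⬦ x) := by
  obtain ⟨f, key⟩ := exists_rep_two P
  simp only [key] at hP ⊢
  obtain ⟨Y, hY⟩ := choice_one (P := fun x y => f ⬦ (x ⬦ (0 : 𝔐.M T0)) ⬦ y = 0) fun x => hP _
  refine ⟨lam fun x => Y ⬦ (kE 𝔐 T0 T0 ⬦ x), fun x => ?_⟩
  have := hY (kE 𝔐 T0 T0 ⬦ x)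
  rw [kE_ap] at this
  rwa [lam_ap]

/-! Definition by cases and bounded quantifiers. -/

/-- Iterating a constant function is already a case distinction on `n = 0`; `Def.ite` applies it to
a characteristic function. -/
theorem cond_pos (a b : 𝔐.M T0) (n : 𝔐.M T0) : n = 0 ∨ two a b ⬦ n = b := by
  refine nat_ind (P := fun n => n = 0 ∨ two a b ⬦ n = b) (Or.inl rfl) (fun n _ => Or.inr ?_) n
  exact (rE_succ _ _ _).trans (kE_ap _ _)

instance Def.ite {Γ : Ctx} (P : DEnv 𝔐 Γ → Prop) [hP : Dec Γ P] {inst : ∀ e, Decidable (P e)}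
    (F G : DEnv 𝔐 Γ → 𝔐.M T0) [Def Γ F] [Def Γ G] : Def Γ (fun e => if P e then F e else G e) := by
  obtain ⟨c, hc, h⟩ := hP
  have : (fun e => if P e then F e else G e) = fun e => HOA.two (F e) (G e) ⬦ c e := by
    funext e
    split_ifs with hp
    · rw [(h e).1 hp, two_zero]
    · exact ((cond_pos _ _ _).resolve_left fun h' => hp ((h e).2 h')).symm
  rw [this]
  infer_instance

open Classical in
/-- The step function of the search for a zero of `h`. -/
noncomputable def searchStep (h : 𝔐.M T1) : 𝔐.M T1 := lam fun i => if h ⬦ i = 0 then i else i + 1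

/-- The least zero of `h` below `n`, or `n` if there is none. -/
noncomputable def search (h : 𝔐.M T1) (n : 𝔐.M T0) : 𝔐.M T0 := rE 𝔐 ⬦ searchStep h ⬦ 0 ⬦ n

instance Def.search {Γ : Ctx} (F : DEnv 𝔐 Γ → 𝔐.M T1) (G : DEnv 𝔐 Γ → 𝔐.M T0) [hF : Def Γ F]
    [Def Γ G] : Def Γ (fun e => search (F e) (G e)) := by
  have : Def (T0 :: Γ) (fun e : DEnv 𝔐 (T0 :: Γ) => F e.2) := ⟨hF.out.snd⟩
  unfold HOA.search searchStep
  infer_instance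

theorem search_zero (h : 𝔐.M T1) : search h 0 = 0 := rE_zero _ _

theorem search_succ (h : 𝔐.M T1) (n : 𝔐.M T0) :
    search h (n + 1) = if h ⬦ search h n = 0 then search h n else search h n + 1 := by
  unfold search
  rw [rE_succ]
  unfold searchStep
  rw [lam_ap]

/-- The recursor gives its step function no access to the stage, so the searched value is its own
counter: it increases by one at each stage until it meets a zero and then rests. -/
theorem search_spec (h : 𝔐.M T1) (n : 𝔐.M T0) :
    (h ⬦ search h n = 0 ∧ search h n < n) ∨ search h n = n := by
  refine nat_ind (P := fun n => (h ⬦ search h n = 0 ∧ search h n < n) ∨ search h n = n)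
    (Or.inr (search_zero h)) (fun n ih => ?_) n
  rw [search_succ]
  split_ifs with h0
  · refine Or.inl ⟨h0, ?_⟩
    rcases ih with ih | ih
    · exact ih.2.trans (lt_add_one n)
    · rw [ih]; exact lt_add_one n
  · exact Or.inr (by rw [ih.resolve_left fun h' => h0 h'.1])

theorem search_min (h : 𝔐.M T1) (n i : 𝔐.M T0) (hi : i < search h n) : h ⬦ i ≠ 0 := by
  revert hi
  refine nat_ind (P := fun n => i < search h n → h ⬦ i ≠ 0) ?_ (fun n ih => ?_) n
  · rw [search_zero]; exact fun h => absurd h (nat_not_lt_zero _)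
  · rw [search_succ]
    split_ifs with h0
    · exact ih
    · intro hi
      rcases (nat_lt_succ_iff.1 hi).lt_or_eq with h' | rfl
      · exact ih h'
      · exact h0

theorem search_lt_iff (h : 𝔐.M T1) (n : 𝔐.M T0) : search h n < n ↔ ∃ i, i < n ∧ h ⬦ i = 0 := by
  constructor
  · intro hl
    exact ⟨_, hl, ((search_spec h n).resolve_right hl.ne).1⟩
  · rintro ⟨i, hi, h0⟩
    by_contra! h'
    exact search_min h n i (hi.trans_le h') h0

section
variable {Γ : Ctx} (P : 𝔐.M T0 → DEnv 𝔐 Γ → Prop) (F : DEnv 𝔐 Γ → 𝔐.M T0)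
  [hP : Dec (T0 :: Γ) (fun e : DEnv 𝔐 (T0 :: Γ) => P e.1 e.2)] [Def Γ F]

instance Dec.exists_lt : Dec Γ (fun e => ∃ i, i < F e ∧ P i e) := by
  obtain ⟨c, hc, h⟩ := hP
  obtain ⟨d, hd, hdc⟩ := hc.exists_rep
  have : Dec Γ (fun e => HOA.search (d e) (F e) < F e) := inferInstance
  have h' : ∀ i e, P i e ↔ c (i, e) = 0 := fun i e => h (i, e)
  simp only [search_lt_iff, hdc, ← h'] at this
  exact this

instance Dec.forall_lt : Dec Γ (fun e => ∀ i, i < F e → P i e) := by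
  have : Dec Γ (fun e => ¬∃ i, i < F e ∧ ¬P i e) := inferInstance
  simpa only [not_exists, not_and, not_not] using this

end

/-- The bound `m < n` keeps the induction predicate decidable. -/
theorem nat_eq_zero_or_succ (n : 𝔐.M T0) : n = 0 ∨ ∃ m, m < n ∧ m + 1 = n :=
  nat_ind (P := fun n => n = 0 ∨ ∃ m, m < n ∧ m + 1 = n) (Or.inl rfl)
    (fun n _ => Or.inr ⟨n, lt_add_one n, rfl⟩) n

/-- A pairing function. -/
def pr (x y : 𝔐.M T0) : 𝔐.M T0 := (x + y) * (x + y) + x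

instance Def.pr {Γ : Ctx} (F G : DEnv 𝔐 Γ → 𝔐.M T0) [Def Γ F] [Def Γ G] :
    Def Γ (fun e => pr (F e) (G e)) := by
  unfold HOA.pr
  infer_instance

/-- Pairs with sum `s` have codes between `s²` and `s² + s`, below `(s + 1)²`. -/
theorem pr_lt_of_add_lt {x y x' y' : 𝔐.M T0} (h : x + y < x' + y') : pr x y < pr x' y' := by
  have h₁ := nat_succ_le h
  calc pr x y ≤ (x + y) * (x + y) + (x + y) :=
        add_le_add_right (le_add_of_nonneg_right (nat_zero_le y)) _
    _ < (x + y) * (x + y) + (x + y) + (x + y + 1) :=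
        lt_add_of_pos_right _ ((nat_zero_le _).trans_lt (lt_add_one _))
    _ = (x + y + 1) * (x + y + 1) := by ring
    _ ≤ (x' + y') * (x' + y') := mul_le_mul h₁ h₁ (nat_zero_le _) (nat_zero_le _)
    _ ≤ pr x' y' := le_add_of_nonneg_right (nat_zero_le _)

theorem pr_inj {x y x' y' : 𝔐.M T0} (h : pr x y = pr x' y') : x = x' ∧ y = y' := by
  rcases lt_trichotomy (x + y) (x' + y') with h' | h' | h'
  · exact absurd h (pr_lt_of_add_lt h').ne
  · have hx : x = x' := by
      unfold pr at h
      rw [h'] at h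
      exact add_left_cancel h
    subst hx
    exact ⟨rfl, add_left_cancel h'⟩
  · exact absurd h (pr_lt_of_add_lt h').ne'

theorem add_le_pr (x y : 𝔐.M T0) : x + y ≤ pr x y := by
  rcases (nat_zero_le (x + y)).eq_or_lt with h | h
  · rw [← h]; exact nat_zero_le _
  · have h₁ := nat_succ_le h
    rw [zero_add] at h₁
    calc x + y = (x + y) * 1 := (mul_one _).symm
      _ ≤ (x + y) * (x + y) := mul_le_mul le_rfl h₁ nat_zero_lt_one.le (nat_zero_le _)
      _ ≤ pr x y := le_add_of_nonneg_right (nat_zero_le _)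

theorem left_lt_pr (x y : 𝔐.M T0) : x < pr x y + 1 :=
  nat_lt_succ_iff.2 ((le_add_of_nonneg_right (nat_zero_le y)).trans (add_le_pr x y))

theorem right_lt_pr (x y : 𝔐.M T0) : y < pr x y + 1 :=
  nat_lt_succ_iff.2 ((le_add_of_nonneg_left (nat_zero_le x)).trans (add_le_pr x y))

variable (𝔐) in
-- The components of a pair are at most its code, so decoding needs only bounded quantifiers and can
-- be obtained by choice. Numbers that are not codes carry no condition.
theorem exists_fst : ∃ p : 𝔐.M T1, ∀ x y, p ⬦ pr x y = x := by
  obtain ⟨p, hp⟩ := choice_zero (𝔐 := 𝔐)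
    (P := fun z x => ∀ x', x' < z + 1 → ∀ y', y' < z + 1 → pr x' y' = z → x = x') (fun z => by
      by_cases h : ∃ x y, pr x y = z
      · obtain ⟨x, y, rfl⟩ := h
        exact ⟨x, fun x' _ y' _ h => (pr_inj h).1.symm⟩
      · exact ⟨0, fun x' _ y' _ h' => (h ⟨x', y', h'⟩).elim⟩)
  exact ⟨p, fun x y => hp _ x (left_lt_pr x y) y (right_lt_pr x y) rfl⟩

variable (𝔐) in
theorem exists_snd : ∃ p : 𝔐.M T1, ∀ x y, p ⬦ pr x y = y := by
  obtain ⟨p, hp⟩ := choice_zero (𝔐 := 𝔐)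
    (P := fun z y => ∀ x', x' < z + 1 → ∀ y', y' < z + 1 → pr x' y' = z → y = y') (fun z => by
      by_cases h : ∃ x y, pr x y = z
      · obtain ⟨x, y, rfl⟩ := h
        exact ⟨y, fun x' _ y' _ h => (pr_inj h).2.symm⟩
      · exact ⟨0, fun x' _ y' _ h' => (h ⟨x', y', h'⟩).elim⟩)
  exact ⟨p, fun x y => hp _ x (left_lt_pr x y) y (right_lt_pr x y) rfl⟩

variable (𝔐) in
noncomputable def fstE : 𝔐.M T1 := (exists_fst 𝔐).choose
variable (𝔐) in
noncomputable def sndE : 𝔐.M T1 := (exists_snd 𝔐).choose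

@[simp] theorem fstE_pr (x y : 𝔐.M T0) : fstE 𝔐 ⬦ pr x y = x := (exists_fst 𝔐).choose_spec x y
@[simp] theorem sndE_pr (x y : 𝔐.M T0) : sndE 𝔐 ⬦ pr x y = y := (exists_snd 𝔐).choose_spec x y

theorem exists_rep_three {ρ σ τ : Ty} (P : 𝔐.M ρ → 𝔐.M σ → 𝔐.M τ → Prop)
    [h : Dec [τ, σ, ρ] (fun e : DEnv 𝔐 [τ, σ, ρ] => P e.2.2.1 e.2.1 e.1)] :
    ∃ f : 𝔐.M (ρ ⇒ σ ⇒ τ ⇒ T0), ∀ x y z, P x y z ↔ f ⬦ x ⬦ y ⬦ z = 0 := by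
  obtain ⟨c, hc, h⟩ := h
  obtain ⟨d, hd, hdc⟩ := hc.exists_rep
  obtain ⟨e, he, hed⟩ := hd.exists_rep
  obtain ⟨f, -, hf⟩ := he.exists_rep
  refine ⟨f (), fun x y z => (h (z, y, x, ())).trans (Eq.congr (Eq.symm ?_) rfl)⟩
  exact (congrArg (fun t => t ⬦ y ⬦ z) (hf x ())).trans
    ((congrArg (· ⬦ z) (hed y (x, ()))).trans (hdc z (y, x, ())))

/-- A choice function for one step is iterated on coded pairs `(n, s)`: the stage has to be part of
the state, because the recursor only iterates a unary function. -/
theorem dependent_choice {R : 𝔐.M T0 → 𝔐.M T0 → Prop} {Q : 𝔐.M T0 → 𝔐.M T0 → 𝔐.M T0 → Prop}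
    [Dec [T0, T0] (fun e : DEnv 𝔐 [T0, T0] => R e.2.1 e.1)]
    [Dec [T0, T0, T0] (fun e : DEnv 𝔐 [T0, T0, T0] => Q e.2.2.1 e.2.1 e.1)]
    (h0 : ∃ s, R 0 s) (hs : ∀ n s, R n s → ∃ s', R (n + 1) s' ∧ Q n s s') :
    ∃ F : 𝔐.M T1, ∀ n, R n (F ⬦ n) ∧ Q n (F ⬦ n) (F ⬦ (n + 1)) := by
  obtain ⟨r, hr⟩ := exists_rep_two R
  obtain ⟨w, hw⟩ := exists_rep_three Q
  simp only [hr, hw] at h0 hs ⊢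
  obtain ⟨s₀, h0⟩ := h0
  obtain ⟨Y, hY⟩ := choice_zero (P := fun z z' : 𝔐.M T0 =>
    r ⬦ (fstE 𝔐 ⬦ z) ⬦ (sndE 𝔐 ⬦ z) = 0 → fstE 𝔐 ⬦ z' = fstE 𝔐 ⬦ z + 1 ∧
      r ⬦ (fstE 𝔐 ⬦ z + 1) ⬦ (sndE 𝔐 ⬦ z') = 0 ∧
      w ⬦ (fstE 𝔐 ⬦ z) ⬦ (sndE 𝔐 ⬦ z) ⬦ (sndE 𝔐 ⬦ z') = 0) (fun z => by
    by_cases h : r ⬦ (fstE 𝔐 ⬦ z) ⬦ (sndE 𝔐 ⬦ z) = 0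
    · obtain ⟨s', h₁, h₂⟩ := hs _ _ h
      exact ⟨pr (fstE 𝔐 ⬦ z + 1) s', fun _ => by simp [h₁, h₂]⟩
    · exact ⟨0, fun h' => (h h').elim⟩)
  have key : ∀ n, fstE 𝔐 ⬦ (rE 𝔐 ⬦ Y ⬦ pr 0 s₀ ⬦ n) = n ∧
      r ⬦ n ⬦ (sndE 𝔐 ⬦ (rE 𝔐 ⬦ Y ⬦ pr 0 s₀ ⬦ n)) = 0 := by
    refine nat_ind (P := fun n => fstE 𝔐 ⬦ (rE 𝔐 ⬦ Y ⬦ pr 0 s₀ ⬦ n) = n ∧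
      r ⬦ n ⬦ (sndE 𝔐 ⬦ (rE 𝔐 ⬦ Y ⬦ pr 0 s₀ ⬦ n)) = 0) ?_ fun n ih => ?_
    · simp [rE_zero, h0]
    · have := hY (rE 𝔐 ⬦ Y ⬦ pr 0 s₀ ⬦ n)
      rw [ih.1] at this
      have := this ih.2
      rw [rE_succ]
      exact ⟨this.1, this.2.1⟩
  refine ⟨lam fun n => sndE 𝔐 ⬦ (rE 𝔐 ⬦ Y ⬦ pr 0 s₀ ⬦ n), fun n => ?_⟩
  simp only [lam_ap]
  refine ⟨(key n).2, ?_⟩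
  have := hY (rE 𝔐 ⬦ Y ⬦ pr 0 s₀ ⬦ n)
  rw [(key n).1] at this
  rw [rE_succ]
  exact (this (key n).2).2.2

/-- Induction for existential statements. -/
theorem nat_ind_exists {R : 𝔐.M T0 → 𝔐.M T0 → Prop}
    [Dec [T0, T0] (fun e : DEnv 𝔐 [T0, T0] => R e.2.1 e.1)]
    (h0 : ∃ s, R 0 s) (hs : ∀ n s, R n s → ∃ s', R (n + 1) s') (n : 𝔐.M T0) : ∃ s, R n s := by
  -- With a trivial relation between successive states, the chosen sequence `F` provides all the
  -- witnesses at once.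
  obtain ⟨F, hF⟩ := dependent_choice (R := R) (Q := fun _ _ _ => True) h0
    (fun n s h => (hs n s h).imp fun _ h => ⟨h, trivial⟩)
  exact ⟨_, (hF n).1⟩

/-! Initial segments and a dense sequence. -/

/-- The initial segments of length `n` of `f` and `g` are equal. -/
def Agree (f g : 𝔐.M T1) (n : 𝔐.M T0) : Prop := ∀ i, i < n → f ⬦ i = g ⬦ i

instance Dec.agree {Γ : Ctx} (F G : DEnv 𝔐 Γ → 𝔐.M T1) (H : DEnv 𝔐 Γ → 𝔐.M T0) [hF : Def Γ F]
    [hG : Def Γ G] [Def Γ H] : Dec Γ (fun e => Agree (F e) (G e) (H e)) := by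
  have : Def (T0 :: Γ) (fun e : DEnv 𝔐 (T0 :: Γ) => F e.2) := ⟨hF.out.snd⟩
  have : Def (T0 :: Γ) (fun e : DEnv 𝔐 (T0 :: Γ) => G e.2) := ⟨hG.out.snd⟩
  unfold Agree
  infer_instance

theorem Agree.symm {f g : 𝔐.M T1} {n : 𝔐.M T0} (h : Agree f g n) : Agree g f n :=
  fun i hi => (h i hi).symm

theorem Agree.trans {f g h : 𝔐.M T1} {n : 𝔐.M T0} (h₁ : Agree f g n) (h₂ : Agree g h n) :
    Agree f h n := fun i hi => (h₁ i hi).trans (h₂ i hi)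

theorem Agree.mono {f g : 𝔐.M T1} {n m : 𝔐.M T0} (h : Agree f g n) (hm : m ≤ n) : Agree f g m :=
  fun i hi => h i (hi.trans_le hm)

theorem agree_succ {f g : 𝔐.M T1} {n : 𝔐.M T0} :
    Agree f g (n + 1) ↔ Agree f g n ∧ f ⬦ n = g ⬦ n := by
  refine ⟨fun h => ⟨h.mono (lt_add_one n).le, h n (lt_add_one n)⟩, fun h i hi => ?_⟩
  rcases (nat_lt_succ_iff.1 hi).lt_or_eq with h' | rfl
  · exact h.1 i h'
  · exact h.2

/-- The sequence coded by `m`. -/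
noncomputable def dseq (m : 𝔐.M T0) : 𝔐.M T1 := lam fun i => fstE 𝔐 ⬦ (rE 𝔐 ⬦ sndE 𝔐 ⬦ m ⬦ i)

instance Def.dseq {Γ : Ctx} (F : DEnv 𝔐 Γ → 𝔐.M T0) [hF : Def Γ F] :
    Def Γ (fun e => dseq (F e)) := by
  have : Def (T0 :: Γ) (fun e : DEnv 𝔐 (T0 :: Γ) => F e.2) := ⟨hF.out.snd⟩
  unfold HOA.dseq
  infer_instance

theorem dseq_pr_zero (a m : 𝔐.M T0) : dseq (pr a m) ⬦ (0 : 𝔐.M T0) = a := by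
  simp [dseq, rE_zero]

theorem dseq_pr_succ (a m i : 𝔐.M T0) : dseq (pr a m) ⬦ (i + 1) = dseq m ⬦ i := by
  have : ∀ i, rE 𝔐 ⬦ sndE 𝔐 ⬦ pr a m ⬦ (i + 1) = rE 𝔐 ⬦ sndE 𝔐 ⬦ m ⬦ i := by
    refine nat_ind (P := fun i => rE 𝔐 ⬦ sndE 𝔐 ⬦ pr a m ⬦ (i + 1) = rE 𝔐 ⬦ sndE 𝔐 ⬦ m ⬦ i) ?_
      fun i ih => ?_
    · rw [rE_succ, rE_zero, rE_zero, sndE_pr]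
    · rw [rE_succ, ih, rE_succ]
  simp [dseq, this]

/-- Pairing prepends an entry, so the code is built from the end: after `k` steps it describes the
last `k` values of `g` below `n`. Thus initial segments, and with them neighbourhoods, can be
quantified over at type 0. -/
theorem exists_dseq_agree (g : 𝔐.M T1) (n : 𝔐.M T0) : ∃ m, Agree g (dseq m) n := by
  obtain ⟨m, hm⟩ := nat_ind_exists (𝔐 := 𝔐) (R := fun k m => ∀ j, j < n + 1 → j + k = n →
    ∀ i, i < k → g ⬦ (j + i) = dseq m ⬦ i) ⟨0, fun _ _ _ i hi => (nat_not_lt_zero i hi).elim⟩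
    (fun k m ih => by
      by_cases h : ∃ j, j + (k + 1) = n
      · obtain ⟨j, hj⟩ := h
        refine ⟨pr (g ⬦ j) m, fun j' _ hj' i hi => ?_⟩
        obtain rfl : j' = j := add_right_cancel (hj'.trans hj.symm)
        rcases nat_eq_zero_or_succ i with rfl | ⟨i, -, rfl⟩
        · rw [add_zero, dseq_pr_zero]
        · rw [dseq_pr_succ, ← ih (j' + 1) _ _ i (lt_of_add_lt_add_right hi)]
          · congr 1; ring
          · rw [nat_lt_succ_iff, ← hj]
            exact add_le_add le_rfl (le_add_of_nonneg_left (nat_zero_le k))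
          · rw [← hj]; ring
      · exact ⟨0, fun j' _ hj' => (h ⟨j', hj'⟩).elim⟩) n
  refine ⟨m, fun i hi => ?_⟩
  have := hm 0 ((nat_zero_le n).trans_lt (lt_add_one n)) (zero_add n) i hi
  rwa [zero_add] at this

open Classical in
/-- The sequences `dseq m`, truncated to Cantor space. -/
noncomputable def bseq (m : 𝔐.M T0) : 𝔐.M T1 := lam fun i => if dseq m ⬦ i = 0 then 0 else 1

instance Def.bseq {Γ : Ctx} (F : DEnv 𝔐 Γ → 𝔐.M T0) [hF : Def Γ F] :
    Def Γ (fun e => bseq (F e)) := by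
  have : Def (T0 :: Γ) (fun e : DEnv 𝔐 (T0 :: Γ) => F e.2) := ⟨hF.out.snd⟩
  unfold HOA.bseq
  infer_instance

/-- Membership in Cantor space. -/
def InC (f : 𝔐.M T1) : Prop := ∀ i, f ⬦ i ≤ 1

theorem nat_le_one {a : 𝔐.M T0} (h : a ≤ 1) : a = 0 ∨ a = 1 := by
  rcases h.lt_or_eq with h | h
  · rw [← zero_add (1 : 𝔐.M T0), nat_lt_succ_iff] at h
    exact Or.inl (h.antisymm (nat_zero_le a))
  · exact Or.inr h

theorem bseq_inC (m : 𝔐.M T0) : InC (bseq m) := by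
  intro i
  unfold bseq
  rw [lam_ap]
  split_ifs
  · exact nat_zero_lt_one.le
  · exact le_rfl

theorem exists_bseq_agree {g : 𝔐.M T1} (hg : InC g) (n : 𝔐.M T0) : ∃ m, Agree g (bseq m) n := by
  obtain ⟨m, hm⟩ := exists_dseq_agree g n
  refine ⟨m, fun i hi => ?_⟩
  unfold bseq
  rw [lam_ap, ← hm i hi]
  rcases nat_le_one (hg i) with h | h <;> simp [h]

/-! The axioms in a model. -/

/-- Continuity on Baire space. -/
def Cont (Y : 𝔐.M T2) : Prop := ∀ f, ∃ N, ∀ g, Agree f g N → Y ⬦ f = Y ⬦ g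

def UnifContC (Y : 𝔐.M T2) (n : 𝔐.M T0) : Prop :=
  ∀ f g, InC f ∧ InC g → Agree f g n → Y ⬦ f = Y ⬦ g

variable (𝔐) in
class HasE2 : Prop where
  out : ∃ φ : 𝔐.M T2, (∀ f, φ ⬦ f ≤ 1) ∧ ∀ f, (∃ n, f ⬦ n = 0) ↔ φ ⬦ f = 0

variable (𝔐) in
class HasE3 : Prop where
  out : ∃ E : 𝔐.M T3, (∀ Y, E ⬦ Y ≤ 1) ∧ ∀ Y, (∃ f, Y ⬦ f = 0) ↔ E ⬦ Y = 0

variable (𝔐) in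
def HasMUC : Prop := ∃ Ω : 𝔐.M T3, ∀ Y, UnifContC Y (Ω ⬦ Y)

variable (𝔐) in
def HasFF : Prop := ∃ Φ : 𝔐.M T3, ∀ Y, Cont Y → UnifContC Y (Φ ⬦ Y)

variable (𝔐) in
def HasZ : Prop := ∃ Z : 𝔐.M T3, ∀ Y, Z ⬦ Y = 0 ↔ Cont Y

section
variable {Γ : Ctx}

/-- With `(∃²)` decidability extends to arithmetical predicates, and so do induction and choice. -/
instance Dec.exists_nat [h2 : HasE2 𝔐] (P : 𝔐.M T0 → DEnv 𝔐 Γ → Prop)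
    [hP : Dec (T0 :: Γ) (fun e : DEnv 𝔐 (T0 :: Γ) => P e.1 e.2)] :
    Dec Γ (fun e => ∃ i, P i e) := by
  obtain ⟨c, hc, h⟩ := hP
  obtain ⟨d, hd, hdc⟩ := hc.exists_rep
  obtain ⟨φ, -, hφ⟩ := h2
  have h' : ∀ i e, P i e ↔ c (i, e) = 0 := fun i e => h (i, e)
  refine .of_def (fun e => φ ⬦ d e) fun e => ?_
  simp only [← hφ, hdc, ← h']

instance Dec.forall_nat [HasE2 𝔐] (P : 𝔐.M T0 → DEnv 𝔐 Γ → Prop)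
    [Dec (T0 :: Γ) (fun e : DEnv 𝔐 (T0 :: Γ) => P e.1 e.2)] : Dec Γ (fun e => ∀ i, P i e) := by
  have : Dec Γ (fun e => ¬∃ i, ¬P i e) := inferInstance
  simpa only [not_exists, not_not] using this

instance Dec.exists_one [h3 : HasE3 𝔐] (P : 𝔐.M T1 → DEnv 𝔐 Γ → Prop)
    [hP : Dec (T1 :: Γ) (fun e : DEnv 𝔐 (T1 :: Γ) => P e.1 e.2)] :
    Dec Γ (fun e => ∃ f, P f e) := by
  obtain ⟨c, hc, h⟩ := hP
  obtain ⟨d, hd, hdc⟩ := hc.exists_rep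
  obtain ⟨E, -, hE⟩ := h3
  have h' : ∀ i e, P i e ↔ c (i, e) = 0 := fun i e => h (i, e)
  refine .of_def (fun e => E ⬦ d e) fun e => ?_
  simp only [← hE, hdc, ← h']

instance Dec.forall_one [HasE3 𝔐] (P : 𝔐.M T1 → DEnv 𝔐 Γ → Prop)
    [Dec (T1 :: Γ) (fun e : DEnv 𝔐 (T1 :: Γ) => P e.1 e.2)] : Dec Γ (fun e => ∀ f, P f e) := by
  have : Dec Γ (fun e => ¬∃ f, ¬P f e) := inferInstance
  simpa only [not_exists, not_not] using this

end

open Classical in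
theorem exists_char {σ : Ty} (P : 𝔐.M σ → Prop) [Dec [σ] (fun e : DEnv 𝔐 [σ] => P e.1)] :
    ∃ φ : 𝔐.M (σ ⇒ T0), (∀ x, φ ⬦ x ≤ 1) ∧ ∀ x, P x ↔ φ ⬦ x = 0 := by
  refine ⟨lam fun x => if P x then 0 else 1, fun x => ?_, fun x => ?_⟩
  · rw [lam_ap]
    split_ifs
    · exact nat_zero_lt_one.le
    · exact le_rfl
  · rw [lam_ap]
    split_ifs with h <;> simp [h]

/-! Discontinuous functionals yield `(∃²)`. -/

theorem search_eq {h : 𝔐.M T1} {a n : 𝔐.M T0} (ha : h ⬦ a = 0) (hm : ∀ i, i < a → h ⬦ i ≠ 0)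
    (hn : a < n) : search h n = a := by
  have h₁ := (search_lt_iff h n).2 ⟨a, hn, ha⟩
  rcases lt_trichotomy (search h n) a with h' | h' | h'
  · exact (hm _ h' ((search_spec h n).resolve_right h₁.ne).1).elim
  · exact h'
  · exact (search_min h n a h' ha).elim

open Classical in
/-- `g` if `h` has no zero, and `G n` if `n` is the least zero of `h`. -/
noncomputable def jump (G : 𝔐.M (T0 ⇒ T1)) (g h : 𝔐.M T1) : 𝔐.M T1 :=
  lam fun k => if search h (k + 1) < k + 1 then G ⬦ search h (k + 1) ⬦ k else g ⬦ k

instance Def.jump {Γ : Ctx} (G : 𝔐.M (T0 ⇒ T1)) (g : 𝔐.M T1) (F : DEnv 𝔐 Γ → 𝔐.M T1)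
    [hF : Def Γ F] : Def Γ (fun e => jump G g (F e)) := by
  have : Def (T0 :: Γ) (fun e : DEnv 𝔐 (T0 :: Γ) => F e.2) := ⟨hF.out.snd⟩
  unfold HOA.jump
  infer_instance

theorem jump_of_forall_ne {G : 𝔐.M (T0 ⇒ T1)} {g h : 𝔐.M T1} (hh : ∀ n, h ⬦ n ≠ 0) :
    jump G g h = g := by
  refine ap_ext fun k => ?_
  unfold jump
  rw [lam_ap, if_neg]
  rw [search_lt_iff]
  exact fun ⟨i, _, hi⟩ => hh i hi

/-- Computing the value at `k` only inspects `h` up to `k`. Before the least zero `n` is seen the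
value is taken from `g`, which agrees with `G ⬦ n` there; afterwards it is taken from `G ⬦ n`. -/
theorem exists_jump_eq {G : 𝔐.M (T0 ⇒ T1)} {g h : 𝔐.M T1} (hG : ∀ n, Agree g (G ⬦ n) n)
    (hh : ∃ n, h ⬦ n = 0) : ∃ n, jump G g h = G ⬦ n := by
  obtain ⟨i, hi⟩ := hh
  have hl := (search_lt_iff h (i + 1)).2 ⟨i, lt_add_one i, hi⟩
  have h0 := ((search_spec h (i + 1)).resolve_right hl.ne).1
  have hm := search_min h (i + 1)
  generalize search h (i + 1) = n at hl h0 hm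
  refine ⟨n, ap_ext fun k => ?_⟩
  unfold jump
  rw [lam_ap]
  rcases lt_or_ge k n with hk | hk
  · rw [if_neg, hG n k hk]
    rw [search_lt_iff]
    rintro ⟨j, hj, hj0⟩
    exact hm j ((nat_lt_succ_iff.1 hj).trans_lt hk) hj0
  · have := search_eq h0 hm (nat_lt_succ_iff.2 hk)
    rw [this, if_pos (nat_lt_succ_iff.2 hk)]

/-- Grilliot's trick: `jump G g h` is `g` if `h` has no zero and some `G ⬦ n` otherwise, so
comparing its value under `Y` with `Y ⬦ g` decides whether `h` has a zero. -/
theorem hasE2_of_sequence {Y : 𝔐.M T2} {G : 𝔐.M (T0 ⇒ T1)} {g : 𝔐.M T1}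
    (hG : ∀ n, Agree g (G ⬦ n) n) (hY : ∀ n, Y ⬦ (G ⬦ n) ≠ Y ⬦ g) : HasE2 𝔐 := by
  obtain ⟨φ, h₁, h₂⟩ := exists_char (𝔐 := 𝔐) fun h => Y ⬦ jump G g h ≠ Y ⬦ g
  refine ⟨φ, h₁, fun f => ?_⟩
  rw [← h₂]
  constructor
  · intro hf
    obtain ⟨n, hn⟩ := exists_jump_eq hG hf
    rw [hn]
    exact hY n
  · intro hf
    by_contra! h
    exact hf (by rw [jump_of_forall_ne h])

/-- The available choice principles select numbers, so the sequence that witnesses discontinuity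
must consist of coded sequences. If coded sequences already show the discontinuity at `f`, their
codes can be chosen. Otherwise `Y` is constant on the coded sequences near `f`, and a nearby `g`
with another value is itself a point of discontinuity that coded sequences witness. -/
theorem hasE2_of_not_cont {Y : 𝔐.M T2} (hY : ¬Cont Y) : HasE2 𝔐 := by
  unfold Cont at hY
  push Not at hY
  obtain ⟨f, hf⟩ := hY
  by_cases h : ∀ N, ∃ m, Agree f (dseq m) N ∧ Y ⬦ dseq m ≠ Y ⬦ f
  · obtain ⟨F, hF⟩ := choice_zero (P := fun N m => Agree f (dseq m) N ∧ Y ⬦ dseq m ≠ Y ⬦ f) h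
    refine hasE2_of_sequence (Y := Y) (G := lam fun n => dseq (F ⬦ n)) (g := f)
      (fun n => ?_) fun n => ?_
    · rw [lam_ap]; exact (hF n).1
    · rw [lam_ap]; exact (hF n).2
  · push Not at h
    obtain ⟨N, hN⟩ := h
    obtain ⟨g, hg, hne⟩ := hf N
    -- Agreement up to `n` is needed for convergence to `g`, agreement up to `N` to stay in the
    -- neighbourhood of `f`.
    obtain ⟨F, hF⟩ := choice_zero (P := fun n m => Agree g (dseq m) (n + N))
      fun n => exists_dseq_agree g (n + N)
    refine hasE2_of_sequence (Y := Y) (G := lam fun n => dseq (F ⬦ n)) (g := g)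
      (fun n => ?_) fun n => ?_
    · rw [lam_ap]; exact (hF n).mono (le_add_of_nonneg_right (nat_zero_le _))
    · rw [lam_ap, hN _ (hg.trans ((hF n).mono (le_add_of_nonneg_left (nat_zero_le _))))]
      exact hne

/-! Consequences of `(∃²)`. -/

/-- No modulus `n` fits `φ` itself: the constant sequence 1 and the sequence whose only zero is at
`n` agree below `n`. -/
theorem not_hasMUC_of_hasE2 [h2 : HasE2 𝔐] : ¬HasMUC 𝔐 := by
  classical
  rintro ⟨Ω, hΩ⟩
  obtain ⟨φ, -, hφ⟩ := h2
  generalize hn : Ω ⬦ φ = n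
  have h := hΩ φ (lam fun _ => 1) (lam fun i => if i = n then 0 else 1)
  rw [hn] at h
  have h0 : φ ⬦ lam (fun i => if i = n then 0 else 1) = 0 := (hφ _).1 ⟨n, by simp⟩
  have h1 : ¬φ ⬦ lam (fun _ => 1) = 0 := fun h => by
    obtain ⟨i, hi⟩ := (hφ _).2 h
    simp at hi
  refine h1 ((h ⟨fun i => ?_, fun i => ?_⟩ fun i hi => ?_).trans h0)
  · simp
  · rw [lam_ap]
    split_ifs
    · exact nat_zero_lt_one.le
    · exact le_rfl
  · simp [hi.ne]

/-- `n` bounds the oscillation of `Y` on the sequences `bseq m`. -/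
def IsMod (Y : 𝔐.M T2) (n : 𝔐.M T0) : Prop :=
  ∀ k l, Agree (bseq k) (bseq l) n → Y ⬦ bseq k = Y ⬦ bseq l

/-- Continuity at `f` and at `g` allows both to be replaced by coded binary sequences agreeing with
them far enough. -/
theorem IsMod.unifContC {Y : 𝔐.M T2} {n : 𝔐.M T0} (h : IsMod Y n) (hY : Cont Y) :
    UnifContC Y n := by
  rintro f g ⟨hf, hg⟩ hfg
  obtain ⟨a, ha⟩ := hY f
  obtain ⟨b, hb⟩ := hY g
  obtain ⟨k, hk⟩ := exists_bseq_agree hf (max n a)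
  obtain ⟨l, hl⟩ := exists_bseq_agree hg (max n b)
  rw [ha _ (hk.mono (le_max_right _ _)), hb _ (hl.mono (le_max_right _ _))]
  exact h k l (((hk.mono (le_max_left _ _)).symm.trans hfg).trans (hl.mono (le_max_left _ _)))

/-- `Y` has no modulus on the neighbourhood of `bseq s` given by `n`. -/
def Bad (Y : 𝔐.M T2) (n s : 𝔐.M T0) : Prop :=
  ∀ a, ∃ k l, Agree (bseq k) (bseq s) n ∧ Agree (bseq l) (bseq s) n ∧
    Agree (bseq k) (bseq l) a ∧ Y ⬦ bseq k ≠ Y ⬦ bseq l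

/-- Bisection as in the proof of compactness: if both halves of the neighbourhood had moduli, their
maximum with `n + 1` would be a modulus for the whole. -/
theorem Bad.exists_succ {Y : 𝔐.M T2} {n s : 𝔐.M T0} (h : Bad Y n s) :
    ∃ s', Bad Y (n + 1) s' ∧ Agree (bseq s) (bseq s') n := by
  by_contra! hc
  have key : ∀ x : 𝔐.M T0, ∃ a, ∀ k l, Agree (bseq k) (bseq s) n → bseq k ⬦ n = x →
      Agree (bseq k) (bseq l) (n + 1) → Agree (bseq k) (bseq l) a →
      Y ⬦ bseq k = Y ⬦ bseq l := by
    intro x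
    by_cases hx : ∃ s', Agree (bseq s) (bseq s') n ∧ bseq s' ⬦ n = x
    · obtain ⟨s', hs, hs'⟩ := hx
      by_contra! hn
      refine hc s' (fun a => ?_) hs
      obtain ⟨k, l, hk, hkx, hkl, hkl', hne⟩ := hn a
      have hk' : Agree (bseq k) (bseq s') (n + 1) := agree_succ.2 ⟨hk.trans hs, hkx.trans hs'.symm⟩
      exact ⟨k, l, hk', hkl.symm.trans hk', hkl', hne⟩
    · exact ⟨0, fun k l hk hkx => (hx ⟨k, hk.symm, hkx⟩).elim⟩
  obtain ⟨a, ha⟩ := key 0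
  obtain ⟨b, hb⟩ := key 1
  -- Agreement up to `n + 1` puts both sequences into the same half.
  obtain ⟨k, l, hk, -, hkl, hne⟩ := h (max (max a b) (n + 1))
  have hab := hkl.mono (le_max_left (max a b) (n + 1))
  have hkl := hkl.mono (le_max_right (max a b) (n + 1))
  rcases nat_le_one (bseq_inC k n) with h0 | h1
  · exact hne (ha k l hk h0 hkl (hab.mono (le_max_left a b)))
  · exact hne (hb k l hk h1 hkl (hab.mono (le_max_right a b)))

instance Dec.bad [HasE2 𝔐] {Γ : Ctx} (Y : 𝔐.M T2) (F G : DEnv 𝔐 Γ → 𝔐.M T0) [hF : Def Γ F]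
    [hG : Def Γ G] : Dec Γ (fun e => Bad Y (F e) (G e)) := by
  have : Def (T0 :: T0 :: T0 :: Γ) (fun e : DEnv 𝔐 (T0 :: T0 :: T0 :: Γ) => F e.2.2.2) :=
    ⟨hF.out.snd.snd.snd⟩
  have : Def (T0 :: T0 :: T0 :: Γ) (fun e : DEnv 𝔐 (T0 :: T0 :: T0 :: Γ) => G e.2.2.2) :=
    ⟨hG.out.snd.snd.snd⟩
  unfold Bad
  infer_instance

instance Dec.isMod [HasE2 𝔐] {Γ : Ctx} (F : DEnv 𝔐 Γ → 𝔐.M T2) (G : DEnv 𝔐 Γ → 𝔐.M T0)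
    [hF : Def Γ F] [hG : Def Γ G] : Dec Γ (fun e => IsMod (F e) (G e)) := by
  have : Def (T0 :: T0 :: Γ) (fun e : DEnv 𝔐 (T0 :: T0 :: Γ) => F e.2.2) := ⟨hF.out.snd.snd⟩
  have : Def (T0 :: T0 :: Γ) (fun e : DEnv 𝔐 (T0 :: T0 :: Γ) => G e.2.2) := ⟨hG.out.snd.snd⟩
  unfold IsMod
  infer_instance

/-- Without a modulus, dependent choice gives nested bad neighbourhoods, since `(∃²)` decides `Bad`.
Continuity of `Y` at their common point `f` makes `Y` constant on one of them, which contradicts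
badness. -/
theorem Cont.exists_isMod [HasE2 𝔐] {Y : 𝔐.M T2} (hY : Cont Y) : ∃ n, IsMod Y n := by
  by_contra! h
  have h0 : Bad Y 0 0 := by
    intro a
    have := h a
    unfold IsMod at this
    push Not at this
    obtain ⟨k, l, h₁, h₂⟩ := this
    exact ⟨k, l, fun i hi => (nat_not_lt_zero i hi).elim, fun i hi => (nat_not_lt_zero i hi).elim,
      h₁, h₂⟩
  obtain ⟨F, hF⟩ := dependent_choice (R := fun n s => Bad Y n s)
    (Q := fun n s s' => Agree (bseq s) (bseq s') n) ⟨0, h0⟩ fun n s hs => hs.exists_succ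
  -- The value at `i` no longer changes from stage `i + 1` on.
  let f : 𝔐.M T1 := lam fun i => bseq (F ⬦ (i + 1)) ⬦ i
  have hf : ∀ n, Agree (bseq (F ⬦ n)) f n := by
    refine nat_ind (P := fun n => Agree (bseq (F ⬦ n)) f n)
      (fun i hi => (nat_not_lt_zero i hi).elim) fun n ih => agree_succ.2 ⟨?_, ?_⟩
    · exact (hF n).2.symm.trans ih
    · exact (lam_ap (fun i => bseq (F ⬦ (i + 1)) ⬦ i) n).symm
  obtain ⟨n, hn⟩ := hY f
  obtain ⟨k, l, hk, hl, -, hne⟩ := (hF n).1 n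
  exact hne ((hn _ (hk.trans (hf n)).symm).symm.trans (hn _ (hl.trans (hf n)).symm))

/-- `QF-AC^{2,0}` chooses moduli. Its premise has to hold for every `Y`, so functionals without a
modulus are admitted by a second alternative, which `(∃²)` also decides. -/
theorem hasFF_of_hasE2 [HasE2 𝔐] : HasFF 𝔐 := by
  obtain ⟨Φ, hΦ⟩ := choice_two (P := fun (Y : 𝔐.M T2) n => IsMod Y n ∨ ∀ n', ¬IsMod Y n')
    fun Y => by
      by_cases h : ∃ n, IsMod Y n
      · exact h.imp fun _ => Or.inl
      · exact ⟨0, Or.inr (not_exists.1 h)⟩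
  refine ⟨Φ, fun Y hY => ?_⟩
  obtain ⟨n, hn⟩ := hY.exists_isMod
  exact ((hΦ Y).resolve_right fun h => h n hn).unifContC hY

/-! The theorem in a model. -/

/-- For the converse: without `(∃²)` all functionals are continuous, so the functional from `FF`
would be one for `MUC`. -/
theorem hasE2_iff : HasE2 𝔐 ↔ HasFF 𝔐 ∧ ¬HasMUC 𝔐 := by
  refine ⟨fun _ => ⟨hasFF_of_hasE2, not_hasMUC_of_hasE2⟩, fun ⟨⟨Φ, hΦ⟩, h⟩ => ?_⟩
  by_contra h2
  exact h ⟨Φ, fun Y => hΦ Y (not_not.1 fun hY => h2 (hasE2_of_not_cont hY))⟩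

theorem hasE2_of_hasE3 [HasE3 𝔐] : HasE2 𝔐 := by
  obtain ⟨φ, h₁, h₂⟩ := exists_char (𝔐 := 𝔐)
    fun f : 𝔐.M T1 => ∃ g : 𝔐.M T1, f ⬦ (g ⬦ (0 : 𝔐.M T0)) = 0
  refine ⟨φ, h₁, fun f => ?_⟩
  rw [← h₂]
  exact ⟨fun ⟨n, hn⟩ => ⟨kE 𝔐 T0 T0 ⬦ n, by rwa [kE_ap]⟩, fun ⟨g, hg⟩ => ⟨_, hg⟩⟩

theorem hasZ_of_hasE3 [HasE3 𝔐] : HasZ 𝔐 := by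
  have : HasE2 𝔐 := hasE2_of_hasE3
  obtain ⟨Z, -, hZ⟩ := exists_char (𝔐 := 𝔐)
    fun Y : 𝔐.M T2 => ∀ f, ∃ N, ∀ g, Agree f g N → Y ⬦ f = Y ⬦ g
  exact ⟨Z, fun Y => (hZ Y).symm⟩

theorem hasZ_of_not_hasE2 (h : ¬HasE2 𝔐) : HasZ 𝔐 :=
  ⟨kE 𝔐 T0 T2 ⬦ 0, fun Y => by
    rw [kE_ap]
    exact iff_of_true rfl (not_not.1 fun hY => h (hasE2_of_not_cont hY))⟩

open Classical in
/-- A functional that is continuous if and only if `Y` has no zero. -/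
noncomputable def witness (Y : 𝔐.M T2) : 𝔐.M T2 := lam fun g =>
  if Y ⬦ (lam fun n => fstE 𝔐 ⬦ (g ⬦ n)) = 0 ∧ ∀ n, sndE 𝔐 ⬦ (g ⬦ n) = 0 then 1 else 0

/-- An argument `g` codes two sequences, and `witness Y` singles out those whose first component is
a zero of `Y` and whose second component vanishes. This set has empty interior, as the second
component can be altered arbitrarily far out; hence the functional is discontinuous at each of its
points, and constant if the set is empty. `(∃²)` is used to decide that the second component
vanishes. -/
theorem cont_witness_iff [HasE2 𝔐] (Y : 𝔐.M T2) : Cont (witness Y) ↔ ¬∃ f, Y ⬦ f = 0 := by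
  classical
  constructor
  · rintro h ⟨f, hf⟩
    obtain ⟨N, hN⟩ := h (lam fun n => pr (f ⬦ n) 0)
    -- The second component is changed only at `N`, just outside the segment that continuity
    -- inspects.
    have h' := hN (lam fun n => if n = N then pr 0 1 else pr (f ⬦ n) 0)
      fun i hi => by simp [hi.ne]
    have hfst : (lam fun n => fstE 𝔐 ⬦ ((lam fun n => pr (f ⬦ n) 0) ⬦ n)) = f :=
      ap_ext fun n => by simp
    unfold witness at h'
    rw [lam_ap, lam_ap, hfst, if_pos ⟨hf, fun n => by simp⟩, if_neg] at h'
    · exact one_ne_zero h'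
    · rintro ⟨-, h⟩
      simpa using h N
  · intro h f
    refine ⟨0, fun g _ => ?_⟩
    unfold witness
    rw [lam_ap, lam_ap, if_neg fun h' => h ⟨_, h'.1⟩, if_neg fun h' => h ⟨_, h'.1⟩]

theorem hasE3_of_hasZ [HasE2 𝔐] (hZ : HasZ 𝔐) : HasE3 𝔐 := by
  obtain ⟨Z, hZ⟩ := hZ
  have : Def [T2] (fun e : DEnv 𝔐 [T2] => witness e.1) := by
    unfold witness
    infer_instance
  obtain ⟨E, h₁, h₂⟩ := exists_char (𝔐 := 𝔐) fun Y => ¬Z ⬦ witness Y = 0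
  refine ⟨E, h₁, fun Y => ?_⟩
  rw [← h₂, hZ, cont_witness_iff, not_not]

theorem hasZ_iff : HasZ 𝔐 ↔ HasE3 𝔐 ∨ ¬HasE2 𝔐 := by
  refine ⟨fun h => ?_, fun h => h.elim (fun _ => hasZ_of_hasE3) hasZ_of_not_hasE2⟩
  by_cases h2 : HasE2 𝔐
  · exact Or.inl (hasE3_of_hasZ h)
  · exact Or.inr h2

theorem hasE3_iff : HasE3 𝔐 ↔ HasFF 𝔐 ∧ HasZ 𝔐 ∧ ¬HasMUC 𝔐 := by
  constructor
  · intro h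
    have h2 := hasE2_iff.1 (hasE2_of_hasE3 (𝔐 := 𝔐))
    exact ⟨h2.1, hasZ_of_hasE3, h2.2⟩
  · rintro ⟨h₁, h₂, h₃⟩
    have : HasE2 𝔐 := hasE2_iff.2 ⟨h₁, h₃⟩
    exact hasE3_of_hasZ h₂

/-! Satisfaction of the axioms. -/

theorem sat_existsTwo : Sat (VEnv.nil (𝔐 := 𝔐.toModel)) existsTwo ↔ HasE2 𝔐 := by
  refine Iff.trans (exists_congr fun φ => and_congr Iff.rfl (forall_congr' fun f => ?_))
    ⟨fun h => ⟨h⟩, fun h => h.out⟩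
  exact iff_iff_implies_and_implies.symm

theorem sat_existsThree : Sat (VEnv.nil (𝔐 := 𝔐.toModel)) existsThree ↔ HasE3 𝔐 := by
  refine Iff.trans (exists_congr fun φ => and_congr Iff.rfl (forall_congr' fun f => ?_))
    ⟨fun h => ⟨h⟩, fun h => h.out⟩
  exact iff_iff_implies_and_implies.symm

theorem sat_MUC : Sat (VEnv.nil (𝔐 := 𝔐.toModel)) MUC ↔ HasMUC 𝔐 := Iff.rfl

theorem sat_FF : Sat (VEnv.nil (𝔐 := 𝔐.toModel)) FF ↔ HasFF 𝔐 := Iff.rfl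

theorem sat_ZThree : Sat (VEnv.nil (𝔐 := 𝔐.toModel)) ZThree ↔ HasZ 𝔐 :=
  exists_congr fun _ => forall_congr' fun _ => iff_iff_implies_and_implies.symm

theorem proves_iff_of_forall {A B : Sentence}
    (h : ∀ 𝔐 : HModel, Sat (VEnv.nil (𝔐 := 𝔐.toModel)) A ↔ Sat (VEnv.nil (𝔐 := 𝔐.toModel)) B) :
    RCAQFAC20.Proves (A.iff B) :=
  proves_of_forall_sat (fun θ h => RCAQFAC20.sub h θ) (fun _ _ h => Or.inl h)
    fun 𝔐 => ⟨(h 𝔐).1, (h 𝔐).2⟩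

end HOA

theorem mainTheorem5 :
    HOA.RCAQFAC20.Proves
        (HOA.Fm.iff HOA.existsTwo (HOA.Fm.and HOA.FF (HOA.Fm.neg HOA.MUC))) ∧
      HOA.RCAQFAC20.Proves
        (HOA.Fm.iff HOA.existsThree
          (HOA.Fm.and HOA.FF (HOA.Fm.and HOA.ZThree (HOA.Fm.neg HOA.MUC)))) ∧
      HOA.RCAQFAC20.Proves
        (HOA.Fm.iff HOA.ZThree (HOA.Fm.or HOA.existsThree (HOA.Fm.neg HOA.existsTwo))) ∧
      HOA.RCAQFAC20.Proves
        (HOA.Fm.iff (HOA.Fm.or HOA.existsThree (HOA.Fm.neg HOA.existsTwo))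
          (HOA.Fm.or HOA.existsThree (HOA.Fm.or (HOA.Fm.neg HOA.FF) HOA.MUC))) := by
  refine ⟨HOA.proves_iff_of_forall fun 𝔐 => ?_, HOA.proves_iff_of_forall fun 𝔐 => ?_,
    HOA.proves_iff_of_forall fun 𝔐 => ?_, HOA.proves_iff_of_forall fun 𝔐 => ?_⟩
  · change _ ↔ _ ∧ (_ → False)
    rw [HOA.sat_existsTwo, HOA.sat_FF, HOA.sat_MUC]
    exact HOA.hasE2_iff
  · change _ ↔ _ ∧ _ ∧ (_ → False)
    rw [HOA.sat_existsThree, HOA.sat_FF, HOA.sat_ZThree, HOA.sat_MUC]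
    exact HOA.hasE3_iff
  · change _ ↔ _ ∨ (_ → False)
    rw [HOA.sat_existsThree, HOA.sat_existsTwo, HOA.sat_ZThree]
    exact HOA.hasZ_iff
  · change _ ∨ (_ → False) ↔ _ ∨ (_ → False) ∨ _
    -- After replacing `(∃²)` by its equivalent, only propositional logic remains.
    rw [HOA.sat_existsThree, HOA.sat_existsTwo, HOA.sat_FF, HOA.sat_MUC, HOA.hasE2_iff]
    tauto
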